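/- **Setting.** Let $E$ be a Euclidean space and $\Delta\subset E$ a reduced crystallographic root system spanning $E$, with base $\Sigma$. For $J\subseteq\Sigma$ let $\pi_J:E\to V:=E/\mathrm{span}\,J$ be the canonical projection, where $V$ carries the inner product obtained by identifying it with $(\mathrm{span}\,J)^\perp$. The quotient root system $R=\Delta/J$ is the set of nonzero elements of $\pi_J(\Delta)$; its base is $S=\pi_J(\Sigma\setminus J)$, and $R^+$ is the set of elements of $R$ that are non-negative integral combinations of $S$. Assume that $R$ is connected, i.e. that the graph on $S$ in which $\theta,\theta'$ are joined when $\langle\theta,\theta'\rangle<0$ is connected (and non-empty). For $I\subseteq S$ let $\pi_I:V\to V/\mathrm{span}\,I$ be the canonical projection, let $R/I$ be the set of nonzero elements of $\pi_I(R)$, with base $S/I=\pi_I(S\setminus I)$ and the corresponding set $(R/I)^+$ of positive elements, and let $R_I^+=R^+\cap\mathrm{span}\,I$. **Definitions.** A set $\Phi\subseteq R^+$ is an *inversion set* if $\alpha+\beta\in\Phi$ whenever $\alpha,\beta\in\Phi$ and $\alpha+\beta\in R$, and $\alpha+\beta\in\Phi^c$ whenever $\alpha,\beta\in\Phi^c$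 and $\alpha+\beta\in R$, where $\Phi^c=R^+\setminus\Phi$. A set $\Phi\subseteq R^+$ is *inflated from* $I\subseteq S$ if $\Phi=\inf_I^S(\Psi,X):=\{\alpha\in R^+:\pi_I(\alpha)\in\Psi\}\cup X$ for some $\Psi\subseteq(R/I)^+$ and $X\subseteq R_I^+$. One also says that $\Phi$ is an inflation of $\Psi$ from $I$. The set $\Phi$ is *primitive* if $\Phi\ne\emptyset$, $\Phi\neq R^+$ and $\Phi$ is inflated from no $I\subseteq S$ other than $\emptyset$ and $S$; the same definitions apply to subsets of $(R/I)^+$ with respect to the base $S/I$. A set $\Phi\subseteq R^+$ is *canonically inflated from* $I$ if $I\subsetneq S$ and $\Phi=\inf_I^S(\Psi,X)$ for some $\Psi,X$ such that either $\Psi$ is primitive, or $\Psi=\emptyset$ and $I$ is the smallest subset of $S$ from which $\Phi$ is an inflation of the empty set, or $\Psi=(R/I)^+$ and $I$ is the smallest subset $K\subseteq S$ such that $\Phi$ is an inflation of $(R/K)^+$ from $K$. Let $G_\Phi^{\Phi^c}$ be the graph with vertex set $\Phi$ in which $\alpha\neq\alpha'$ are joined by an edge if $\alpha-\alpha'\in\Phi^c$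 or $\alpha'-\alpha\in\Phi^c$. **Statement.** Let $\Phi\subseteq R^+$ be an inversion set that is canonically inflated from $I$. Then: (1) every connected component of $G_\Phi^{\Phi^c}$ (as a subset of $R^+$) is inflated from $I$; (2) whenever $\Phi=\Phi_1\sqcup\Phi_2$ is a disjoint union of two inversion sets $\Phi_1,\Phi_2$ of $R^+$, both $\Phi_1$ and $\Phi_2$ are inflated from $I$. -/

import Mathlib

/-! Quotient root systems, inversion sets, inflations and their canonical form.

A quotient root system `R` with base `S` is handled as a pair of subsets `R`, `S` of a real vector
space `V`. -/

namespace QRS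

section Linear

variable {V : Type*} [AddCommGroup V] [Module ℝ V]

/-- The canonical projection `π_I : V → V / span I`. -/
abbrev proj (I : Set V) : V →ₗ[ℝ] V ⧸ Submodule.span ℝ I :=
  (Submodule.span ℝ I).mkQ

/-- `R / I`: the nonzero images of the elements of `R` in `V / span I`. -/
def quotRoots (R I : Set V) : Set (V ⧸ Submodule.span ℝ I) :=
  {x | x ≠ 0 ∧ ∃ α ∈ R, proj I α = x}

/-- `S / I`: the images of the elements of `S \ I` in `V / span I`. -/
def quotBase (S I : Set V) : Set (V ⧸ Submodule.span ℝ I) :=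
  {x | ∃ θ ∈ S \ I, proj I θ = x}

/-- `R⁺`: the elements of `R` that are combinations of elements of `S` with nonnegative integer
coefficients. -/
def pos (R S : Set V) : Set V :=
  {α | α ∈ R ∧ α ∈ AddSubmonoid.closure S}

/-- `Φ ⊆ R⁺` is an inversion set: it is closed and co-closed. -/
structure IsInversionSet (R S Φ : Set V) : Prop where
  subset : Φ ⊆ pos R S
  closed : ∀ α ∈ Φ, ∀ β ∈ Φ, α + β ∈ R → α + β ∈ Φ
  coclosed : ∀ α ∈ pos R S \ Φ, ∀ β ∈ pos R S \ Φ, α + β ∈ R → α + β ∈ pos R S \ Φ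

/-- `Φ` is the inflation from `I` of `Ψ ⊆ (R / I)⁺` by `X ⊆ R_I⁺ = R⁺ ∩ span I`, that is,
`Φ = π_I⁻¹(Ψ) ∪ X`, where the preimage is taken in `R⁺`. -/
structure IsInflation (R S I Φ : Set V) (Ψ : Set (V ⧸ Submodule.span ℝ I)) (X : Set V) :
    Prop where
  subset_base : I ⊆ S
  subset_quot : Ψ ⊆ pos (quotRoots R I) (quotBase S I)
  subset_zero : X ⊆ pos R S ∩ Submodule.span ℝ I
  eq : Φ = {α | α ∈ pos R S ∧ proj I α ∈ Ψ} ∪ X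

/-- `Gen(Φ)`: the set of all `I ⊆ S` such that `Φ` is inflated from `I`. -/
def gen (R S Φ : Set V) : Set (Set V) :=
  {I | ∃ Ψ X, IsInflation R S I Φ Ψ X}

/-- `Φ ⊆ R⁺` is primitive: it is neither empty nor `R⁺`, and it is inflated from no subset of `S`
other than `∅` and `S`. -/
structure IsPrimitive (R S Φ : Set V) : Prop where
  subset : Φ ⊆ pos R S
  ne_empty : Φ ≠ ∅
  ne_pos : Φ ≠ pos R S
  eq_or_eq : ∀ I Ψ X, IsInflation R S I Φ Ψ X → I = ∅ ∨ I = S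

/-- `Φ = inf_I^S(Ψ, X)` is the canonical form of `Φ`: `I` is a proper subset of `S`, and `Ψ` is
primitive in `(R / I)⁺`, or `Ψ = ∅` and `I` is the smallest set from which `Φ` is an inflation of
`∅`, or `Ψ = (R / I)⁺` and `I` is the smallest set `K` such that `Φ` is an inflation of
`(R / K)⁺` from `K`. -/
structure IsCanonicalForm (R S I Φ : Set V) (Ψ : Set (V ⧸ Submodule.span ℝ I)) (X : Set V) :
    Prop where
  inflation : IsInflation R S I Φ Ψ X
  proper : I ≠ S
  cases :
    IsPrimitive (quotRoots R I) (quotBase S I) Ψ ∨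
    (Ψ = ∅ ∧ IsLeast {K | ∃ Y, IsInflation R S K Φ ∅ Y} I) ∨
    (Ψ = pos (quotRoots R I) (quotBase S I) ∧
      IsLeast {K | ∃ Y, IsInflation R S K Φ (pos (quotRoots R K) (quotBase S K)) Y} I)

/-- `Φ` is canonically inflated from `I`. -/
def IsCanonicallyInflated (R S I Φ : Set V) : Prop :=
  ∃ Ψ X, IsCanonicalForm R S I Φ Ψ X

/-- The graph `G_A^B`: its vertices are the elements of `A`, and `α`, `β` are joined by an edge
if `α - β ∈ ±B`. -/
def graph (A B : Set V) : SimpleGraph A :=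
  SimpleGraph.fromRel fun α β => (α : V) - (β : V) ∈ B

/-- `C ⊆ A` is (the vertex set of) a connected component of the graph `G_A^B`. -/
def IsComponent (A B C : Set V) : Prop :=
  ∃ c : (graph A B).ConnectedComponent, C = Subtype.val '' c.supp

end Linear

section Euclidean

variable {V : Type*} [SeminormedAddCommGroup V] [InnerProductSpace ℝ V]

/-- The adjacency diagram of a base `S`: distinct `θ`, `η` are joined by an edge if and only if
`⟨θ, η⟩ < 0`. On a quotient `E / span J` of a Euclidean space `E` the inner product is the one of
the orthogonal complement of `span J`, under the identification of the two spaces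
(`Submodule.quotientEquivOrthogonal`). -/
def adjacencyDiagram (S : Set V) : SimpleGraph S :=
  SimpleGraph.fromRel fun θ η => inner ℝ (θ : V) (η : V) < 0

end Euclidean

end QRS

/-!
The proof replaces the reflections and root strings, which a quotient root system `R` lacks, by one
property of the inner product: two elements of `R` with negative inner product have a sum in
`R ∪ {0}`. It descends from `Δ` to `Δ / J` because the sum of all roots of `Δ` in a fibre of the
projection is invariant under the reflections of `J`, hence orthogonal to `span J`, so that some
member of the fibre has negative inner product with a given root (`exists_lift_inner_neg`,
`isRootSystem_quotRoots`). It implies `IsRootSystem.three`: if `x + y + z` is a root, then so is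
`x + y` or `x + z`, up to vanishing partial sums.

Both parts of the theorem follow from one assertion (`IsRootSystem.mem_gen_of_step`): a subset `D`
of `Φ` that is closed under the edges of the graph is inflated from `I`. Components are closed in this
sense by definition, and the two parts of a decomposition are since they are co-closed. What has to
be shown is that elements of `Φ` outside `span I` that are congruent modulo `span I` are joined by
a path in the graph.

The main tool is the stabilizer `stab R F` of a symmetric set `F` of roots. It is closed and
symmetric, and a closed symmetric set of roots that contains a co-closed set `X` of positive roots
contains every simple root in the support of `X` (`IsRootSystem.subset_span_of_coclosed`). In
a connected root system only `∅` and `R` are stabilized by all simple roots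
(`IsRootSystem.subset_of_stab`).

If `Φ` contains all positive roots outside `span I`, then `Φᶜ` is co-closed and stabilizes the set
of roots that can be reached from a given one. By the leastness of `I`, so do the simple roots of
`I` (`mem_of_full`).

If `Φ` is the inflation of a primitive set, let `θ` be a root in `span I` and call `α ∈ Φ` outside
`span I` bad if `α + θ` is a root that no path joins to `α`, where only steps outside `span I` are
admitted. Suppose that there are bad roots. Steps lead from bad roots to bad roots, and the steps
`δ` that occur (the labels) satisfy `δ ± θ ∉ R` (`bad_add`); moreover a label added to any bad root
gives a bad root or no root (`add_mem_sym_of_label`). Hence the bad roots stabilize the set of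
elements of `±Φᶜ` outside `span I` that are not labels. The bad roots together with `R⁺ ∩ span I`
form a co-closed set (`bad_coclosed`), and `Φ` is inflated from its support; since this support is
larger than `I`, it is the whole base by primitivity. So every simple root stabilizes the set of
non-labels, which therefore is empty: every `δ ∈ ±Φᶜ` outside `span I` satisfies `δ + θ ∉ R`
(`notMem_of_bad`). Now the roots `γ ∈ span I` with `γ + δ ∉ R` for all these `δ` form a nonempty set
that is stabilized by `Φᶜ` and by `R ∩ span I`. The support of `Φᶜ ∪ (R⁺ ∩ span I)` is the whole
base, again by primitivity, so this set of roots is all of `R`, which is absurd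
(`link_of_primitive`).
-/

namespace QRS

open Module

/-! ### Root systems with a base -/

/-- The set `±A`. -/
def sym {V : Type*} [AddCommGroup V] (A : Set V) : Set V := {x | x ∈ A ∨ -x ∈ A}

lemma neg_mem_sym {V : Type*} [AddCommGroup V] {A : Set V} {x : V} : -x ∈ sym A ↔ x ∈ sym A := by
  simp [sym, or_comm]

section Abstract

variable {V κ : Type*} [SeminormedAddCommGroup V] [InnerProductSpace ℝ V]

/-- The properties of a quotient root system `R` with base `b` on which the argument rests. Apart
from the sign-coherence of coordinates, the essential one is `add_root`: two roots with negative
inner product have a sum that is a root or zero. There are no reflections and no root strings.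
The inner product comes with a seminorm only, so its definiteness is listed. -/
structure IsRootSystem (b : Basis κ ℝ V) (R : Set V) : Prop where
  definite : ∀ x : V, inner ℝ x x = 0 → x = 0
  zero_notMem : (0 : V) ∉ R
  neg_root : ∀ α ∈ R, -α ∈ R
  base_root : ∀ k, b k ∈ R
  coord : ∀ α ∈ R, ∃ n : κ → ℤ, (∀ k, b.repr α k = n k) ∧ ((∀ k, 0 ≤ n k) ∨ ∀ k, n k ≤ 0)
  pos_iff : ∀ α, α ∈ pos R (Set.range b) ↔ α ∈ R ∧ ∀ k, 0 ≤ b.repr α k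
  add_root : ∀ α ∈ R, ∀ β ∈ R, inner ℝ α β < 0 → α + β ≠ 0 → α + β ∈ R

lemma mem_span_iff {b : Basis κ ℝ V} {I : Set κ} {x : V} :
    x ∈ Submodule.span ℝ (b '' I) ↔ ∀ k, k ∉ I → b.repr x k = 0 := by
  rw [Basis.mem_span_image]
  constructor
  · intro h k hk
    by_contra h0
    exact hk (h (by simpa using h0))
  · intro h k hk
    by_contra h0
    exact (by simpa using hk : b.repr x k ≠ 0) (h k h0)

namespace IsRootSystem

variable {b : Basis κ ℝ V} {R : Set V}

lemma inner_self_pos (H : IsRootSystem b R) {x : V} (hx : x ≠ 0) : 0 < inner ℝ x x :=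
  lt_of_le_of_ne real_inner_self_nonneg fun h => hx (H.definite x h.symm)

lemma ne_zero (H : IsRootSystem b R) {α : V} (hα : α ∈ R) : α ≠ 0 :=
  fun h => H.zero_notMem (h ▸ hα)

lemma neg_root_iff (H : IsRootSystem b R) {α : V} : -α ∈ R ↔ α ∈ R :=
  ⟨fun h => by simpa using H.neg_root _ h, H.neg_root α⟩

lemma inner_nonneg (H : IsRootSystem b R) {α β : V} (hα : α ∈ R) (hβ : β ∈ R)
    (h : α + β ∉ R) (h0 : α + β ≠ 0) : 0 ≤ inner ℝ α β := by
  by_contra hlt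
  exact h (H.add_root α hα β hβ (not_le.1 hlt) h0)

lemma inner_nonpos (H : IsRootSystem b R) {α β : V} (hα : α ∈ R) (hβ : β ∈ R)
    (h : α - β ∉ R) (h0 : α - β ≠ 0) : inner ℝ α β ≤ 0 := by
  have := H.inner_nonneg hα (H.neg_root β hβ) (by rwa [← sub_eq_add_neg])
    (by rwa [← sub_eq_add_neg])
  rw [inner_neg_right] at this
  linarith

lemma sub_root (H : IsRootSystem b R) {α β : V} (hα : α ∈ R) (hβ : β ∈ R)
    (h : 0 < inner ℝ α β) (h0 : α - β ≠ 0) : α - β ∈ R := by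
  by_contra hn
  exact absurd (H.inner_nonpos hα hβ hn h0) (not_le.2 h)

lemma inner_eq_zero (H : IsRootSystem b R) {α β : V} (hα : α ∈ R) (hβ : β ∈ R)
    (h : α + β ∉ R) (h0 : α + β ≠ 0) (h' : α - β ∉ R) (h0' : α - β ≠ 0) : inner ℝ α β = 0 :=
  le_antisymm (H.inner_nonpos hα hβ h' h0') (H.inner_nonneg hα hβ h h0)

/-- If a sum of three roots is a root, then so is one of the two partial sums that contain a given
summand `x`, unless that partial sum is zero. It replaces the Jacobi identity. -/
lemma three (H : IsRootSystem b R) {x y z : V} (hx : x ∈ R) (hy : y ∈ R) (hz : z ∈ R)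
    (h : x + y + z ∈ R) (h0 : y + z ≠ 0) (hxy : x + y ≠ 0) (hxz : x + z ≠ 0) :
    x + y ∈ R ∨ x + z ∈ R := by
  by_contra hn
  push Not at hn
  have h1 := H.inner_nonneg hx hy hn.1 hxy
  have h2 := H.inner_nonneg hx hz hn.2 hxz
  have h3 := H.inner_nonpos h hy (by simpa [add_right_comm x y z] using hn.2)
    (by simpa [add_right_comm x y z] using hxz)
  have h4 := H.inner_nonpos h hz (by simpa using hn.1) (by simpa using hxy)
  have h5 := H.inner_self_pos h0
  simp only [inner_add_left, inner_add_right] at *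
  linarith

lemma pos_or_neg_pos (H : IsRootSystem b R) {α : V} (hα : α ∈ R) :
    α ∈ pos R (Set.range b) ∨ -α ∈ pos R (Set.range b) := by
  obtain ⟨n, hn, h | h⟩ := H.coord α hα
  · left
    exact (H.pos_iff α).2 ⟨hα, fun k => by rw [hn]; exact_mod_cast h k⟩
  · right
    refine (H.pos_iff _).2 ⟨H.neg_root α hα, fun k => ?_⟩
    have := h k
    rw [map_neg, Finsupp.neg_apply, hn]
    have : (n k : ℝ) ≤ 0 := by exact_mod_cast h k
    linarith

lemma notMem_pos_of_neg (H : IsRootSystem b R) {α : V} (h : -α ∈ pos R (Set.range b)) :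
    α ∉ pos R (Set.range b) := by
  intro h'
  have h1 := ((H.pos_iff _).1 h').2
  have h2 := ((H.pos_iff _).1 h).2
  refine H.ne_zero h'.1 (b.repr.map_eq_zero_iff.1 (Finsupp.ext fun k => ?_))
  have := h2 k
  rw [map_neg, Finsupp.neg_apply] at this
  exact le_antisymm (by simpa using this) (h1 k)

lemma base_pos (H : IsRootSystem b R) (k : κ) : b k ∈ pos R (Set.range b) :=
  ⟨H.base_root k, AddSubmonoid.subset_closure ⟨k, rfl⟩⟩

/-- A root outside `span I` has the same sign as the roots that are congruent to it. -/
lemma mem_pos_of_sub_mem (H : IsRootSystem b R) {I : Set κ} {α β : V}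
    (hα : α ∈ pos R (Set.range b)) (hαI : α ∉ Submodule.span ℝ (b '' I)) (hβ : β ∈ R)
    (h : β - α ∈ Submodule.span ℝ (b '' I)) : β ∈ pos R (Set.range b) := by
  refine (H.pos_or_neg_pos hβ).resolve_right fun hn => hαI (mem_span_iff.2 fun k hk => ?_)
  have h1 := mem_span_iff.1 h k hk
  have h2 := ((H.pos_iff _).1 hn).2 k
  have h3 := ((H.pos_iff _).1 hα).2 k
  rw [map_sub, Finsupp.sub_apply] at h1
  rw [map_neg, Finsupp.neg_apply] at h2
  linarith

lemma mem_span_of_add (H : IsRootSystem b R) {I : Set κ} {α β : V}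
    (hα : α ∈ pos R (Set.range b)) (hβ : β ∈ pos R (Set.range b))
    (h : α + β ∈ Submodule.span ℝ (b '' I)) : α ∈ Submodule.span ℝ (b '' I) := by
  refine mem_span_iff.2 fun k hk => ?_
  have h1 := mem_span_iff.1 h k hk
  have h2 := ((H.pos_iff _).1 hα).2 k
  have h3 := ((H.pos_iff _).1 hβ).2 k
  rw [map_add, Finsupp.add_apply] at h1
  linarith

variable [Fintype κ]

/-- The height of a vector: the sum of its coordinates. -/
noncomputable def height (b : Basis κ ℝ V) (x : V) : ℝ := ∑ k, b.repr x k

lemma height_add (b : Basis κ ℝ V) (x y : V) :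
    height b (x + y) = height b x + height b y := by
  simp [height, Finset.sum_add_distrib]

lemma one_le_height (H : IsRootSystem b R) {α : V} (hα : α ∈ pos R (Set.range b)) :
    1 ≤ height b α := by
  obtain ⟨n, hn, -⟩ := H.coord α hα.1
  have h0 : ∀ k, 0 ≤ n k := fun k => by
    have := ((H.pos_iff _).1 hα).2 k
    rw [hn] at this
    exact_mod_cast this
  have : height b α = ((∑ k, n k : ℤ) : ℝ) := by simp [height, hn]
  rw [this]
  have h1 : 1 ≤ ∑ k, n k := by
    by_contra hlt
    have h2 : ∑ k, n k = 0 := le_antisymm (by omega) (Finset.sum_nonneg fun k _ => h0 k)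
    rw [Finset.sum_eq_zero_iff_of_nonneg fun k _ => h0 k] at h2
    exact H.ne_zero hα.1 (b.repr.map_eq_zero_iff.1
      (Finsupp.ext fun k => by simp [hn, h2 k (Finset.mem_univ k)]))
  exact_mod_cast h1

lemma inner_eq_sum (b : Basis κ ℝ V) (x y : V) :
    inner ℝ x y = ∑ k, b.repr x k * inner ℝ (b k) y := by
  nth_rw 1 [← b.sum_repr x]
  rw [sum_inner]
  simp only [real_inner_smul_left]

/-- A positive root that is not simple stays a positive root after some simple root is
subtracted. -/
lemma exists_sub_base_mem_pos (H : IsRootSystem b R) {α : V} (hα : α ∈ pos R (Set.range b))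
    (hne : ∀ k, α ≠ b k) : ∃ k, α - b k ∈ pos R (Set.range b) := by
  have h0 := H.inner_self_pos (H.ne_zero hα.1)
  rw [inner_eq_sum b] at h0
  obtain ⟨k, -, hk⟩ := Finset.exists_lt_of_sum_lt (s := Finset.univ) (f := fun _ : κ => (0 : ℝ))
    (by simpa using h0)
  have hn := ((H.pos_iff _).1 hα).2
  have hk2 : 0 < inner ℝ (b k) α := by
    by_contra hle
    exact absurd hk (not_lt.2 (mul_nonpos_of_nonneg_of_nonpos (hn k) (not_lt.1 hle)))
  have hmem := H.sub_root hα.1 (H.base_root k) (by rwa [real_inner_comm])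
    (sub_ne_zero.2 (hne k))
  refine ⟨k, (H.pos_or_neg_pos hmem).resolve_right fun hneg => hne k ?_⟩
  -- otherwise `α` and `b k - α` both have nonnegative coordinates, so `α` is a multiple of `b k`
  have h2 := ((H.pos_iff _).1 hneg).2
  have hz : ∀ j, j ≠ k → b.repr α j = 0 := fun j hj => by
    have := h2 j
    simp [Finsupp.single_eq_of_ne hj] at this
    exact le_antisymm this (hn j)
  have h3 := H.one_le_height hα
  rw [height, Finset.sum_eq_single k (fun j _ hj => hz j hj) (by simp)] at h3
  have h4 := h2 k
  simp at h4
  refine b.repr.injective (Finsupp.ext fun j => ?_)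
  by_cases hj : j = k
  · subst hj; simp; linarith
  · simp [hz j hj, Finsupp.single_eq_of_ne hj]

/-- Two congruent roots modulo `span I`, not in `span I`, are joined by a path of roots whose steps
add or subtract simple roots of `I`. -/
lemma mem_of_sub_mem_span (H : IsRootSystem b R) {I : Set κ} {F : Set V}
    (hF : ∀ x ∈ F, ∀ k ∈ I, ∀ v, (v = b k ∨ v = -b k) → x + v ∈ R → x + v ∈ F)
    {x y : V} (hxR : x ∈ R) (hyR : y ∈ R) (hx : x ∉ Submodule.span ℝ (b '' I))
    (h : x - y ∈ Submodule.span ℝ (b '' I)) (hxF : x ∈ F) : y ∈ F := by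
  classical
  obtain ⟨N, hN⟩ := exists_nat_ge (∑ k, |b.repr (x - y) k|)
  induction N generalizing x y with
  | zero =>
    have h0 : ∑ k, |b.repr (x - y) k| = 0 :=
      le_antisymm (by simpa using hN) (Finset.sum_nonneg fun k _ => abs_nonneg _)
    rw [Finset.sum_eq_zero_iff_of_nonneg fun k _ => abs_nonneg _] at h0
    have : x - y = 0 := b.repr.map_eq_zero_iff.1
      (Finsupp.ext fun k => by simpa using h0 k (Finset.mem_univ k))
    rwa [← sub_eq_zero.1 this]
  | succ N ih =>
    by_cases hxy : x - y = 0
    · rwa [← sub_eq_zero.1 hxy]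
    have hy : y ∉ Submodule.span ℝ (b '' I) := fun hy => hx (by
      simpa using add_mem h hy)
    -- some simple root of `I`, up to sign, has positive inner product with `x - y` and
    -- brings `x` closer to `y` when it is subtracted
    obtain ⟨v, k, hkI, hv, hinner, hdec⟩ : ∃ v, ∃ k ∈ I, (v = b k ∨ v = -b k) ∧
        0 < inner ℝ (x - y) v ∧ ∑ j, |b.repr (x - y - v) j| ≤ N := by
      have h0 := H.inner_self_pos hxy
      rw [inner_eq_sum b] at h0
      obtain ⟨k, -, hk⟩ := Finset.exists_lt_of_sum_lt (s := Finset.univ)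
        (f := fun _ : κ => (0 : ℝ)) (by simpa only [Finset.sum_const_zero] using h0)
      have hkI : k ∈ I := by
        by_contra hkI
        rw [mem_span_iff.1 h k hkI, zero_mul] at hk
        exact lt_irrefl _ hk
      obtain ⟨n, hn, -⟩ := H.coord x hxR
      obtain ⟨m, hm, -⟩ := H.coord y hyR
      have hint : b.repr (x - y) k = ((n k - m k : ℤ) : ℝ) := by simp [hn, hm]
      have hsum : ∀ v, (∀ j, j ≠ k → b.repr v j = 0) →
          |b.repr (x - y) k - b.repr v k| + 1 = |b.repr (x - y) k| →
          ∑ j, |b.repr (x - y - v) j| ≤ N := by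
        intro v hv hvk
        have e1 : ∑ j ∈ Finset.univ.erase k, |b.repr (x - y - v) j| =
            ∑ j ∈ Finset.univ.erase k, |b.repr (x - y) j| :=
          Finset.sum_congr rfl fun j hj => by
            rw [map_sub _ (x - y), Finsupp.sub_apply, hv j (Finset.mem_erase.1 hj).1, sub_zero]
        have e2 : |b.repr (x - y - v) k| + 1 = |b.repr (x - y) k| := by
          rw [map_sub _ (x - y), Finsupp.sub_apply, hvk]
        rw [← Finset.add_sum_erase _ _ (Finset.mem_univ k)] at hN ⊢
        push_cast at hN
        linarith
      rw [real_inner_comm] at hk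
      rcases lt_trichotomy (b.repr (x - y) k) 0 with hc | hc | hc
      · have h1 : b.repr (x - y) k ≤ -1 := by
          rw [hint] at hc ⊢
          have h2 : n k - m k < 0 := by exact_mod_cast hc
          exact_mod_cast (by omega : n k - m k ≤ -1)
        refine ⟨-b k, k, hkI, Or.inr rfl, ?_, hsum _ (fun j hj => ?_) ?_⟩
        · rw [inner_neg_right]
          nlinarith
        · simp [Finsupp.single_eq_of_ne hj]
        · rw [map_neg, Finsupp.neg_apply, Basis.repr_self, Finsupp.single_eq_same,
            abs_of_nonpos (by linarith), abs_of_nonpos (by linarith)]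
          ring
      · rw [hc, zero_mul] at hk
        exact absurd hk (lt_irrefl _)
      · have h1 : 1 ≤ b.repr (x - y) k := by
          rw [hint] at hc ⊢
          have h2 : 0 < n k - m k := by exact_mod_cast hc
          exact_mod_cast (by omega : 1 ≤ n k - m k)
        refine ⟨b k, k, hkI, Or.inl rfl, ?_, hsum _ (fun j hj => ?_) ?_⟩
        · exact pos_of_mul_pos_right hk hc.le
        · simp [Finsupp.single_eq_of_ne hj]
        · rw [Basis.repr_self, Finsupp.single_eq_same,
            abs_of_nonneg (by linarith), abs_of_nonneg (by linarith)]
          ring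
    have hvI : v ∈ Submodule.span ℝ (b '' I) := by
      have : b k ∈ Submodule.span ℝ (b '' I) := Submodule.subset_span ⟨k, hkI, rfl⟩
      rcases hv with rfl | rfl
      exacts [this, neg_mem this]
    have hvR : v ∈ R := by
      rcases hv with rfl | rfl
      exacts [H.base_root k, H.neg_root _ (H.base_root k)]
    have hv' : -v = b k ∨ -v = -b k := by
      rcases hv with rfl | rfl <;> simp
    rw [inner_sub_left] at hinner
    by_cases hxv : 0 < inner ℝ x v
    · have hR := H.sub_root hxR hvR hxv (fun h0 => hx (by rwa [sub_eq_zero.1 h0]))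
      refine ih hR hyR (fun h' => hx (by simpa using add_mem h' hvI))
        (by simpa [sub_right_comm] using sub_mem h hvI) ?_ (by rwa [sub_right_comm])
      rw [sub_eq_add_neg] at hR ⊢
      exact hF x hxF k hkI _ hv' hR
    · have hR := H.add_root y hyR v hvR (by linarith) (fun h0 => hy (by
        rw [eq_neg_of_add_eq_zero_left h0]; exact neg_mem hvI))
      have := hF _ (ih hxR hR hx (by simpa [sub_add_eq_sub_sub] using sub_mem h hvI) hxF
        (by rwa [sub_add_eq_sub_sub])) k hkI _ hv'
      rw [add_neg_cancel_right] at this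
      exact this hyR

end IsRootSystem

end Abstract

/-! ### Closed symmetric sets of roots and stabilizers -/

section Stabilizer

variable {V κ : Type*} [SeminormedAddCommGroup V] [InnerProductSpace ℝ V]
variable {b : Basis κ ℝ V} {R : Set V}

/-- A set `T` of roots that is closed under negation and under those sums that are roots. -/
structure IsClosedSymm (R T : Set V) : Prop where
  subset : T ⊆ R
  neg : ∀ γ ∈ T, -γ ∈ T
  add : ∀ γ ∈ T, ∀ δ ∈ T, γ + δ ∈ R → γ + δ ∈ T

/-- The roots `γ` that stabilize a set `F` of roots: adding `γ` to an element of `F` never leads to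
a root outside `F`. -/
def stab (R F : Set V) : Set V := {γ | γ ∈ R ∧ ∀ x ∈ F, x + γ ∈ R → x + γ ∈ F}

namespace IsRootSystem

lemma isClosedSymm_stab (H : IsRootSystem b R) {F : Set V} (hF : F ⊆ R)
    (hneg : ∀ x ∈ F, -x ∈ F) : IsClosedSymm R (stab R F) := by
  have hn : ∀ γ ∈ stab R F, -γ ∈ stab R F := by
    refine fun γ hγ => ⟨H.neg_root γ hγ.1, fun x hx hR => ?_⟩
    have h1 : -x + γ = -(x + -γ) := by abel
    have := hγ.2 (-x) (hneg x hx) (by rw [h1]; exact H.neg_root _ hR)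
    rw [h1] at this
    simpa using hneg _ this
  refine ⟨fun γ hγ => hγ.1, hn, fun γ hγ δ hδ hR => ⟨hR, fun y hy hyR => ?_⟩⟩
  -- a partial sum may be zero, and then the other summand itself has to be shown to lie in `F`
  have aux : ∀ γ ∈ stab R F, ∀ δ ∈ stab R F, γ + δ ∈ R → γ ∈ F → δ ∈ F := by
    intro γ hγ δ hδ hR hγF
    have h1 := (hn γ hγ).2 _ (hδ.2 γ hγF hR)
    rw [show γ + δ + -γ = δ by abel] at h1
    exact h1 hδ.1
  rw [← add_assoc] at hyR ⊢
  by_cases h1 : y + γ = 0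
  · rw [h1, zero_add]
    exact aux γ hγ δ hδ hR (by rw [← neg_eq_of_add_eq_zero_right h1]; exact hneg y hy)
  by_cases h2 : y + δ = 0
  · rw [add_right_comm, h2, zero_add]
    exact aux δ hδ γ hγ (by rwa [add_comm])
      (by rw [← neg_eq_of_add_eq_zero_right h2]; exact hneg y hy)
  rcases H.three (hF hy) hγ.1 hδ.1 hyR (H.ne_zero hR) h1 h2 with h | h
  · exact hδ.2 _ (hγ.2 y hy h) hyR
  · rw [add_right_comm] at hyR ⊢
    exact hγ.2 _ (hδ.2 y hy h) hyR

variable [Fintype κ]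

lemma mem_of_mem_pos_of_mem_span (H : IsRootSystem b R) {T : Set V} (hT : IsClosedSymm R T)
    {γ : V} (hγ : γ ∈ pos R (Set.range b)) (h : γ ∈ Submodule.span ℝ (b '' {k | b k ∈ T})) :
    γ ∈ T := by
  obtain ⟨N, hN⟩ := exists_nat_ge (height b γ)
  induction N generalizing γ with
  | zero =>
    have := H.one_le_height hγ
    norm_num at hN
    linarith
  | succ N ih =>
    by_cases hs : ∃ k, γ = b k
    · obtain ⟨k, rfl⟩ := hs
      exact b.self_mem_span_image.1 h
    · push Not at hs
      obtain ⟨k, hk⟩ := H.exists_sub_base_mem_pos hγ hs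
      have e : γ - b k + b k = γ := sub_add_cancel _ _
      have h1 := H.mem_span_of_add hk (H.base_pos k) (by rwa [e])
      have h2 := H.mem_span_of_add (H.base_pos k) hk (by rwa [add_comm, e])
      have h3 := height_add b (γ - b k) (b k)
      have h4 := H.one_le_height (H.base_pos k)
      rw [e] at h3
      push_cast at hN
      have := hT.add _ (ih hk h1 (by linarith)) _ (b.self_mem_span_image.1 h2) (by
        rw [e]; exact hγ.1)
      rwa [e] at this

/-- If two congruent roots modulo `span I` are given and one of them is the sum of two roots outside
`span I`, then the other one is a sum of two roots congruent to these. -/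
lemma exists_add_of_sub_mem_span (H : IsRootSystem b R) {I : Set κ} {γ η ξ : V}
    (hγ : γ ∈ R) (hη : η ∈ R) (hγη : γ + η ∈ R) (hξ : ξ ∈ R)
    (hγI : γ ∉ Submodule.span ℝ (b '' I)) (hηI : η ∉ Submodule.span ℝ (b '' I))
    (hI : γ + η ∉ Submodule.span ℝ (b '' I))
    (h : γ + η - ξ ∈ Submodule.span ℝ (b '' I)) :
    ∃ γ' ∈ R, ∃ η' ∈ R, γ' - γ ∈ Submodule.span ℝ (b '' I) ∧
      η' - η ∈ Submodule.span ℝ (b '' I) ∧ ξ = γ' + η' := by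
  have key := H.mem_of_sub_mem_span (I := I) (F := {z | z ∈ R ∧ ∃ γ' ∈ R, ∃ η' ∈ R,
    γ' - γ ∈ Submodule.span ℝ (b '' I) ∧ η' - η ∈ Submodule.span ℝ (b '' I) ∧ z = γ' + η'})
    ?_ hγη hξ hI h ⟨hγη, γ, hγ, η, hη, by simp, by simp, rfl⟩
  · exact key.2
  rintro _ ⟨hzR, γ', hγ', η', hη', h1, h2, rfl⟩ k hk v hv hR
  have hvI : v ∈ Submodule.span ℝ (b '' I) := by
    have : b k ∈ Submodule.span ℝ (b '' I) := Submodule.subset_span ⟨k, hk, rfl⟩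
    rcases hv with rfl | rfl
    exacts [this, neg_mem this]
  have hvR : v ∈ R := by
    rcases hv with rfl | rfl
    exacts [H.base_root k, H.neg_root _ (H.base_root k)]
  have hne : ∀ x y : V, x ∉ Submodule.span ℝ (b '' I) → y - x ∈ Submodule.span ℝ (b '' I) →
      v + y ≠ 0 := by
    intro x y hx hyx h0
    apply hx
    have : y = -v := (neg_eq_of_add_eq_zero_right h0).symm
    rw [this] at hyx
    have := neg_mem (add_mem hyx hvI)
    simpa using this
  refine ⟨hR, ?_⟩
  rcases H.three hvR hγ' hη' (by rwa [add_assoc, add_comm]) (H.ne_zero hzR) (hne _ _ hγI h1)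
    (hne _ _ hηI h2) with h | h
  · exact ⟨_, h, η', hη', by rw [add_sub_assoc]; exact add_mem hvI h1, h2, by abel⟩
  · exact ⟨γ', hγ', _, h, h1, by rw [add_sub_assoc]; exact add_mem hvI h2, by abel⟩

/-- A co-closed set `X` of positive roots is generated by simple roots in the following sense: a
closed symmetric set `T` that contains `X` contains all simple roots in the support of `X`. -/
lemma subset_span_of_coclosed (H : IsRootSystem b R) {X T : Set V}
    (hX : X ⊆ pos R (Set.range b))
    (hco : ∀ μ ∈ pos R (Set.range b), ∀ ν ∈ pos R (Set.range b), μ + ν ∈ X → μ ∈ X ∨ ν ∈ X)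
    (hT : IsClosedSymm R T) (hXT : X ⊆ T) :
    X ⊆ Submodule.span ℝ (b '' {k | b k ∈ T}) := by
  set L : Set κ := {k | b k ∈ T} with hL
  intro ξ hξ
  obtain ⟨N, hN⟩ := exists_nat_ge (height b ξ)
  induction N generalizing ξ with
  | zero =>
    have := H.one_le_height (hX hξ)
    norm_num at hN
    linarith
  | succ N ih =>
    by_contra hξL
    -- descent on the roots of `T` that are congruent to `ξ` modulo `span L`
    suffices hdesc : ∀ (M : ℕ) (τ : V), τ ∈ pos R (Set.range b) → τ ∈ T →
        τ - ξ ∈ Submodule.span ℝ (b '' L) → height b τ ≤ M → False by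
      obtain ⟨M, hM⟩ := exists_nat_ge (height b ξ)
      exact hdesc M ξ (hX hξ) (hXT hξ) (by simp) hM
    intro M
    induction M with
    | zero =>
      intro τ hτ _ _ hM
      have := H.one_le_height hτ
      norm_num at hM
      linarith
    | succ M ihM =>
      intro τ hτ hτT hτξ hM
      have hτL : τ ∉ Submodule.span ℝ (b '' L) := fun h => hξL (by
        simpa using sub_mem h hτξ)
      have hne : ∀ k, τ ≠ b k := by
        rintro k rfl
        exact hτL (Submodule.subset_span ⟨k, hτT, rfl⟩)
      obtain ⟨k, hk⟩ := H.exists_sub_base_mem_pos hτ hne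
      have e : τ - b k + b k = τ := sub_add_cancel _ _
      have h3 := height_add b (τ - b k) (b k)
      have h4 := H.one_le_height (H.base_pos k)
      rw [e] at h3
      by_cases hkT : b k ∈ T
      · have hkL : b k ∈ Submodule.span ℝ (b '' L) := Submodule.subset_span ⟨k, hkT, rfl⟩
        refine ihM (τ - b k) hk ?_ (by simpa [sub_right_comm] using sub_mem hτξ hkL) ?_
        · have := hT.add _ hτT _ (hT.neg _ hkT)
          rw [← sub_eq_add_neg] at this
          exact this hk.1
        · push_cast at hM
          linarith
      have hkL : b k ∉ Submodule.span ℝ (b '' L) := fun h => hkT (b.self_mem_span_image.1 h)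
      have hγL : τ - b k ∉ Submodule.span ℝ (b '' L) := by
        intro h
        have h5 := hT.add _ hτT _ (hT.neg _ (H.mem_of_mem_pos_of_mem_span hT hk h))
        rw [show τ + -(τ - b k) = b k by abel] at h5
        exact hkT (h5 (H.base_root k))
      obtain ⟨γ', hγ', η', hη', h1, h2, rfl⟩ := H.exists_add_of_sub_mem_span hk.1
        (H.base_root k) (by rw [e]; exact hτ.1) (hX hξ).1 hγL hkL (by rwa [e]) (by rwa [e])
      have hγ'p := H.mem_pos_of_sub_mem hk hγL hγ' h1
      have hη'p := H.mem_pos_of_sub_mem (H.base_pos k) hkL hη' h2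
      have h5 := H.one_le_height hγ'p
      have h6 := H.one_le_height hη'p
      rw [height_add] at hN
      push_cast at hN
      rcases hco _ hγ'p _ hη'p hξ with h | h
      · exact hγL (by simpa using sub_mem (ih h (by linarith)) h1)
      · exact hkL (by simpa using sub_mem (ih h (by linarith)) h2)

/-- In a connected root system, the only nonempty symmetric set of roots that is stabilized by
all simple roots is the set of all roots. -/
lemma subset_of_stab (H : IsRootSystem b R)
    (hconn : ∀ A : Set κ, A.Nonempty → (∀ i ∈ A, ∀ j, inner ℝ (b i) (b j) < 0 → j ∈ A) →
      A = Set.univ)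
    {F : Set V} (hF : F ⊆ R) (hneg : ∀ x ∈ F, -x ∈ F) (hne : F.Nonempty)
    (hstab : ∀ k, b k ∈ stab R F) : R ⊆ F := by
  have hstab' : ∀ k, -b k ∈ stab R F :=
    fun k => (H.isClosedSymm_stab hF hneg).neg _ (hstab k)
  have hsimple : ∃ k, b k ∈ F := by
    obtain ⟨x, hx⟩ := hne
    wlog hpos : x ∈ pos R (Set.range b) generalizing x
    · exact this (-x) (hneg x hx) ((H.pos_or_neg_pos (hF hx)).resolve_left hpos)
    obtain ⟨N, hN⟩ := exists_nat_ge (height b x)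
    induction N generalizing x with
    | zero =>
      have := H.one_le_height hpos
      norm_num at hN
      linarith
    | succ N ih =>
      by_cases hs : ∃ k, x = b k
      · obtain ⟨k, rfl⟩ := hs
        exact ⟨k, hx⟩
      · push Not at hs
        obtain ⟨k, hk⟩ := H.exists_sub_base_mem_pos hpos hs
        have h3 := height_add b (x - b k) (b k)
        have h4 := H.one_le_height (H.base_pos k)
        rw [sub_add_cancel] at h3
        push_cast at hN
        refine ih (x - b k) ?_ hk (by linarith)
        have := (hstab' k).2 x hx
        rw [← sub_eq_add_neg] at this
        exact this hk.1
  have hall : ∀ k, b k ∈ F := by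
    have := hconn {k | b k ∈ F} hsimple (fun i hi j hij => by
      have hne0 : b i + b j ≠ 0 := fun h0 => H.notMem_pos_of_neg (α := b i)
        (by rw [neg_eq_of_add_eq_zero_right h0]; exact H.base_pos j) (H.base_pos i)
      have hR := H.add_root _ (H.base_root i) _ (H.base_root j) hij hne0
      have h1 := (hstab j).2 _ hi hR
      have h2 := (hstab' i).2 _ h1
      rw [show b i + b j + -b i = b j by abel] at h2
      exact h2 (H.base_root j))
    intro k
    have hk : k ∈ {k | b k ∈ F} := by rw [this]; trivial
    exact hk
  have hposF : ∀ x ∈ pos R (Set.range b), x ∈ F := by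
    intro x hpos
    obtain ⟨N, hN⟩ := exists_nat_ge (height b x)
    induction N generalizing x with
    | zero =>
      have := H.one_le_height hpos
      norm_num at hN
      linarith
    | succ N ih =>
      by_cases hs : ∃ k, x = b k
      · obtain ⟨k, rfl⟩ := hs
        exact hall k
      · push Not at hs
        obtain ⟨k, hk⟩ := H.exists_sub_base_mem_pos hpos hs
        have h3 := height_add b (x - b k) (b k)
        have h4 := H.one_le_height (H.base_pos k)
        rw [sub_add_cancel] at h3
        push_cast at hN
        have := (hstab k).2 _ (ih (x - b k) hk (by linarith))
        rw [sub_add_cancel] at this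
        exact this hpos.1
  intro x hx
  rcases H.pos_or_neg_pos hx with h | h
  · exact hposF x h
  · simpa using hneg _ (hposF _ h)

end IsRootSystem

end Stabilizer

/-! ### Inversion sets that are inflated from a set of simple roots -/

section Inflated

variable {V κ : Type*} [SeminormedAddCommGroup V] [InnerProductSpace ℝ V]
variable {b : Basis κ ℝ V} {R : Set V} {I : Set κ} {Φ : Set V}

/-- `Φ` is an inversion set of `R⁺` whose part outside `span I` is a union of fibres of the
projection along `span I`. -/
structure IsInflatedInversionSet (b : Basis κ ℝ V) (R : Set V) (I : Set κ) (Φ : Set V) :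
    Prop where
  root : IsRootSystem b R
  inv : IsInversionSet R (Set.range b) Φ
  fibre : ∀ x ∈ Φ, x ∉ Submodule.span ℝ (b '' I) → ∀ y ∈ pos R (Set.range b),
    y - x ∈ Submodule.span ℝ (b '' I) → y ∈ Φ

/-- The complement `Φᶜ = R⁺ \ Φ`. -/
def compl (b : Basis κ ℝ V) (R Φ : Set V) : Set V := pos R (Set.range b) \ Φ

/-- The elements of `±Φᶜ` outside `span I`. -/
def outer (b : Basis κ ℝ V) (R : Set V) (I : Set κ) (Φ : Set V) : Set V :=
  {δ | δ ∈ sym (compl b R Φ) ∧ δ ∉ Submodule.span ℝ (b '' I)}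

/-- `x` and `y` are joined by a path in `Φ` whose steps lie in `±Φᶜ`, outside `span I`. -/
def Link (b : Basis κ ℝ V) (R : Set V) (I : Set κ) (Φ : Set V) : V → V → Prop :=
  Relation.ReflTransGen fun x y => x ∈ Φ ∧ y ∈ Φ ∧ y - x ∈ outer b R I Φ

/-- The roots `α ∈ Φ` outside `span I` for which `α + θ` is a root that no path joins to `α`. -/
def bad (b : Basis κ ℝ V) (R : Set V) (I : Set κ) (Φ : Set V) (θ : V) : Set V :=
  {α | α ∈ Φ ∧ α ∉ Submodule.span ℝ (b '' I) ∧ α + θ ∈ R ∧ ¬ Link b R I Φ α (α + θ)}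

lemma link_symm : ∀ {x y : V}, Link b R I Φ x y → Link b R I Φ y x := by
  intro x y h
  have : Std.Symm fun x y : V => x ∈ Φ ∧ y ∈ Φ ∧ y - x ∈ outer b R I Φ := ⟨?_⟩
  · exact symm_of (Relation.ReflTransGen _) h
  rintro x y ⟨hx, hy, h1, h2⟩
  refine ⟨hy, hx, ?_, fun h => h2 ?_⟩
  · rw [← neg_sub]; exact neg_mem_sym.2 h1
  · rw [← neg_sub]; exact neg_mem h

lemma neg_mem_outer {δ : V} (h : δ ∈ outer b R I Φ) : -δ ∈ outer b R I Φ :=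
  ⟨neg_mem_sym.2 h.1, fun h' => h.2 (by simpa using neg_mem h')⟩

/-- If none of `α + β`, `α - β`, `α + β + θ` is a root, then `α ⊥ β`, the inner products `⟨α, θ⟩`
and `⟨β, θ⟩` are nonnegative, and `⟨α + θ, β + θ⟩ ≤ 0`, which contradicts `⟨θ, θ⟩ > 0`. -/
lemma IsRootSystem.false_of_add_mem (H : IsRootSystem b R) {α β θ : V} (hα : α ∈ R) (hβ : β ∈ R)
    (hθ : θ ∈ R) (hαθ : α + θ ∈ R) (hβθ : β + θ ∈ R) (h1 : α + β ∉ R) (h1' : α + β ≠ 0)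
    (h2 : α - β ∉ R) (h2' : α - β ≠ 0) (h3 : α + β + θ ∉ R) (h3' : α + β + θ ≠ 0) : False := by
  have e1 := H.inner_eq_zero hα hβ h1 h1' h2 h2'
  have e2 := H.inner_nonneg hαθ hβ (by rwa [add_right_comm]) (by rwa [add_right_comm])
  have e3 := H.inner_nonneg hα hβθ (by rwa [← add_assoc]) (by rwa [← add_assoc])
  have e4 := H.inner_nonpos hαθ hβθ (by rwa [add_sub_add_right_eq_sub])
    (by rwa [add_sub_add_right_eq_sub])
  have e5 := H.inner_self_pos (H.ne_zero hθ)
  simp only [inner_add_left, inner_add_right] at *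
  linarith

namespace IsInflatedInversionSet

lemma sym_subset (C : IsInflatedInversionSet b R I Φ) {x : V} (hx : x ∈ sym Φ) : x ∈ R := by
  rcases hx with h | h
  exacts [(C.inv.subset h).1, C.root.neg_root_iff.1 (C.inv.subset h).1]

lemma sym_compl_subset (C : IsInflatedInversionSet b R I Φ) {x : V}
    (hx : x ∈ sym (compl b R Φ)) : x ∈ R := by
  rcases hx with h | h
  exacts [h.1.1, C.root.neg_root_iff.1 h.1.1]

lemma sym_or (C : IsInflatedInversionSet b R I Φ) {x : V} (hx : x ∈ R) :
    x ∈ sym Φ ∨ x ∈ sym (compl b R Φ) := by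
  by_cases h : x ∈ sym Φ
  · exact Or.inl h
  · refine Or.inr ?_
    simp only [sym, Set.mem_ofPred_eq, not_or] at h
    exact (C.root.pos_or_neg_pos hx).imp (fun h' => ⟨h', h.1⟩) (fun h' => ⟨h', h.2⟩)

lemma notMem_sym_compl (C : IsInflatedInversionSet b R I Φ) {x : V} (hx : x ∈ sym Φ) :
    x ∉ sym (compl b R Φ) := by
  rintro (h | h) <;> rcases hx with h' | h'
  · exact h.2 h'
  · exact C.root.notMem_pos_of_neg (C.inv.subset h') h.1
  · exact C.root.notMem_pos_of_neg h.1 (C.inv.subset h')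
  · exact h.2 h'

lemma add_mem_of_mem_sym (C : IsInflatedInversionSet b R I Φ) {x δ : V} (hx : x ∈ Φ)
    (hδ : δ ∈ sym (compl b R Φ)) (h : x + δ ∈ sym Φ) : x + δ ∈ Φ := by
  rcases h with h | h
  · exact h
  · have e : x + -(x + δ) = -δ := by abel
    have := C.inv.closed x hx _ h (by rw [e]; exact C.root.neg_root _ (C.sym_compl_subset hδ))
    rw [e] at this
    exact absurd hδ (C.notMem_sym_compl (Or.inr this))

lemma mem_of_sub_mem (C : IsInflatedInversionSet b R I Φ) {x y : V} (hx : x ∈ Φ)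
    (hxI : x ∉ Submodule.span ℝ (b '' I)) (hy : y ∈ R)
    (h : y - x ∈ Submodule.span ℝ (b '' I)) : y ∈ Φ :=
  C.fibre x hx hxI y (C.root.mem_pos_of_sub_mem (C.inv.subset hx) hxI hy h) h

lemma notMem_of_sub_mem {x y : V} (hx : x ∉ Submodule.span ℝ (b '' I))
    (h : y - x ∈ Submodule.span ℝ (b '' I)) : y ∉ Submodule.span ℝ (b '' I) :=
  fun hy => hx (by simpa using sub_mem hy h)

lemma mem_sym_of_sub_mem (C : IsInflatedInversionSet b R I Φ) {x y : V} (hx : x ∈ sym Φ)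
    (hxI : x ∉ Submodule.span ℝ (b '' I)) (hy : y ∈ R)
    (h : y - x ∈ Submodule.span ℝ (b '' I)) : y ∈ sym Φ := by
  rcases hx with hx | hx
  · exact Or.inl (C.mem_of_sub_mem hx hxI hy h)
  · refine Or.inr (C.mem_of_sub_mem hx (fun h' => hxI (by simpa using neg_mem h'))
      (C.root.neg_root _ hy) ?_)
    rw [neg_sub_neg, ← neg_sub]
    exact neg_mem h

lemma mem_outer_of_sub_mem (C : IsInflatedInversionSet b R I Φ) {x y : V}
    (hx : x ∈ outer b R I Φ) (hy : y ∈ R)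
    (h : y - x ∈ Submodule.span ℝ (b '' I)) : y ∈ outer b R I Φ := by
  have hyI := notMem_of_sub_mem hx.2 h
  refine ⟨(C.sym_or hy).resolve_left fun hy' => ?_, hyI⟩
  refine C.notMem_sym_compl (C.mem_sym_of_sub_mem hy' hyI (C.sym_compl_subset hx.1) ?_) hx.1
  rw [← neg_sub]
  exact neg_mem h

/-- A root outside `span I` that is not in `±Φ` is in `outer`. -/
lemma mem_outer_of_notMem (C : IsInflatedInversionSet b R I Φ) {x : V} (hx : x ∈ R)
    (hxI : x ∉ Submodule.span ℝ (b '' I)) (h1 : x ∉ Φ) (h2 : -x ∉ Φ) : x ∈ outer b R I Φ :=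
  ⟨(C.sym_or hx).resolve_left (not_or.2 ⟨h1, h2⟩), hxI⟩

lemma add_ne_zero_of_outer (C : IsInflatedInversionSet b R I Φ) {x δ : V} (hx : x ∈ Φ)
    (hδ : δ ∈ outer b R I Φ) : x + δ ≠ 0 := by
  intro h
  have : -δ = x := (eq_neg_of_add_eq_zero_left h).symm
  exact C.notMem_sym_compl (Or.inr (this ▸ hx)) hδ.1

lemma add_notMem_span (C : IsInflatedInversionSet b R I Φ) {x δ : V} (hx : x ∈ Φ)
    (hxI : x ∉ Submodule.span ℝ (b '' I)) (hδ : δ ∈ outer b R I Φ) :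
    x + δ ∉ Submodule.span ℝ (b '' I) := by
  intro h
  refine C.notMem_sym_compl (Or.inr (C.mem_of_sub_mem hx hxI
    (C.root.neg_root _ (C.sym_compl_subset hδ.1)) ?_)) hδ.1
  rw [show -δ - x = -(x + δ) by abel]
  exact neg_mem h

lemma link_of_outer {x δ : V} (hx : x ∈ Φ)
    (hδ : δ ∈ outer b R I Φ) (h : x + δ ∈ Φ) : Link b R I Φ x (x + δ) :=
  Relation.ReflTransGen.single ⟨hx, h, by simpa using hδ⟩

/-- The roles of `α` and `α + θ` are symmetric. -/
lemma bad_neg (C : IsInflatedInversionSet b R I Φ) {θ α : V}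
    (hθI : θ ∈ Submodule.span ℝ (b '' I)) (hα : α ∈ bad b R I Φ θ) :
    α + θ ∈ bad b R I Φ (-θ) := by
  refine ⟨C.mem_of_sub_mem hα.1 hα.2.1 hα.2.2.1 (by simpa using hθI),
    notMem_of_sub_mem hα.2.1 (by simpa using hθI), ?_, fun h => hα.2.2.2 ?_⟩
  · rw [add_neg_cancel_right]
    exact (C.inv.subset hα.1).1
  · rw [add_neg_cancel_right] at h
    exact link_symm h

/-- Badness propagates along the steps of paths, and only roots `δ` for which neither of `δ ± θ` is
a root occur as such steps. -/
lemma bad_add (C : IsInflatedInversionSet b R I Φ) {θ α δ : V} (hθ : θ ∈ R)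
    (hθI : θ ∈ Submodule.span ℝ (b '' I)) (hα : α ∈ bad b R I Φ θ)
    (hδ : δ ∈ outer b R I Φ) (h : α + δ ∈ sym Φ) :
    α + δ ∈ bad b R I Φ θ ∧ δ + θ ∉ R ∧ δ - θ ∉ R := by
  have hαθ := (C.bad_neg hθI hα).1
  have hαδ := C.add_mem_of_mem_sym hα.1 hδ.1 h
  have hαδI := C.add_notMem_span hα.1 hα.2.1 hδ
  have hl := link_of_outer hα.1 hδ hαδ
  have h1 : δ - θ ∉ R := by
    intro hR
    have ho := C.mem_outer_of_sub_mem hδ hR (by simpa using neg_mem hθI)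
    refine hα.2.2.2 (hl.trans (link_symm ?_))
    have e : α + δ = α + θ + (δ - θ) := by abel
    rw [e] at hαδ ⊢
    exact link_of_outer hαθ ho hαδ
  have h2 : θ + (α + δ) ∈ R := by
    refine (C.root.three hθ (C.sym_subset h) (C.root.neg_root _ (C.sym_compl_subset hδ.1))
      ?_ ?_ ?_ ?_).resolve_right fun hR => h1 ?_
    · rw [show θ + (α + δ) + -δ = α + θ by abel]; exact hα.2.2.1
    · rw [add_neg_cancel_right]; exact C.root.ne_zero (C.inv.subset hα.1).1
    · intro h0
      apply hαδI
      rw [eq_neg_of_add_eq_zero_right h0]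
      exact neg_mem hθI
    · intro h0
      apply hδ.2
      rwa [← eq_neg_of_add_eq_zero_left h0 |>.trans (neg_neg δ)]
    · rw [← C.root.neg_root_iff]
      rwa [neg_sub, sub_eq_add_neg]
  rw [add_comm] at h2
  have h3 : α + δ + θ ∈ Φ := C.mem_of_sub_mem hαδ hαδI h2 (by simpa using hθI)
  have hl2 : Link b R I Φ (α + θ) (α + δ + θ) := by
    rw [add_right_comm] at h3 ⊢
    exact link_of_outer hαθ hδ h3
  refine ⟨⟨hαδ, hαδI, h2, fun hl3 => hα.2.2.2 (hl.trans (hl3.trans (link_symm hl2)))⟩,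
    fun hR => ?_, h1⟩
  have ho := C.mem_outer_of_sub_mem hδ hR (by simpa using hθI)
  refine hα.2.2.2 (Relation.ReflTransGen.trans ?_ (link_symm hl2))
  rw [add_assoc] at h3 ⊢
  exact link_of_outer hα.1 ho h3

/-- The steps that join two bad roots. -/
def labels (b : Basis κ ℝ V) (R : Set V) (I : Set κ) (Φ : Set V) (θ : V) : Set V :=
  {d | d ∈ outer b R I Φ ∧ ∃ x ∈ bad b R I Φ θ, x + d ∈ bad b R I Φ θ}

lemma neg_mem_labels {θ d : V} (h : d ∈ labels b R I Φ θ) : -d ∈ labels b R I Φ θ := by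
  obtain ⟨ho, x, hx, hxd⟩ := h
  exact ⟨neg_mem_outer ho, x + d, hxd, by rwa [add_neg_cancel_right]⟩

lemma sub_ne_zero_of_outer {θ d : V} (hθI : θ ∈ Submodule.span ℝ (b '' I))
    (hd : d ∈ outer b R I Φ) : d - θ ≠ 0 :=
  fun h => hd.2 (by rwa [sub_eq_zero.1 h])

lemma add_ne_zero_of_outer' {θ d : V} (hθI : θ ∈ Submodule.span ℝ (b '' I))
    (hd : d ∈ outer b R I Φ) : d + θ ≠ 0 :=
  fun h => hd.2 (by rw [eq_neg_of_add_eq_zero_left h]; exact neg_mem hθI)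

lemma inner_label (C : IsInflatedInversionSet b R I Φ) {θ d : V} (hθ : θ ∈ R)
    (hθI : θ ∈ Submodule.span ℝ (b '' I)) (hd : d ∈ outer b R I Φ)
    (h1 : d + θ ∉ R) (h2 : d - θ ∉ R) : inner ℝ d θ = 0 :=
  C.root.inner_eq_zero (C.sym_compl_subset hd.1) hθ h1 (add_ne_zero_of_outer' hθI hd) h2
    (sub_ne_zero_of_outer hθI hd)

/-- A label that can be added to some bad root leads to a bad root, never to `±Φᶜ`. -/
lemma add_mem_sym_of_label (C : IsInflatedInversionSet b R I Φ) {θ d x : V} (hθ : θ ∈ R)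
    (hθI : θ ∈ Submodule.span ℝ (b '' I)) (hd : d ∈ labels b R I Φ θ)
    (hx : x ∈ bad b R I Φ θ) (hxd : x + d ∈ R) : x + d ∈ sym Φ := by
  -- Suppose that `y = x + d` is in `±Φᶜ`, and let the label `d` join the bad roots `a`, `a + d`.
  -- Then `r = x - a` turns out to be a label, too, and `y + θ` to be a root, whereas
  -- `a + y + θ` is not a root. The inner products of these roots are incompatible.
  by_contra hcon
  obtain ⟨hdo, a, ha, had⟩ := hd
  have H := C.root
  have haR := (C.inv.subset ha.1).1
  have hxR := (C.inv.subset hx.1).1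
  have hadR := (C.inv.subset had.1).1
  have hdR := C.sym_compl_subset hdo.1
  have hxθ := (C.bad_neg hθI hx).1
  have haθ := (C.bad_neg hθI ha).1
  obtain ⟨-, hd1, hd2⟩ := C.bad_add hθ hθI ha hdo (Or.inl had.1)
  obtain ⟨y, hy⟩ : ∃ y, y = x + d := ⟨_, rfl⟩
  rw [← hy] at hxd hcon
  have hyo : y ∈ outer b R I Φ :=
    ⟨(C.sym_or hxd).resolve_left hcon, hy ▸ C.add_notMem_span hx.1 hx.2.1 hdo⟩
  have hyΦ : y ∉ Φ := fun h => hcon (Or.inl h)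
  have hyθ : θ + y ∈ R := by
    refine (H.three hθ hxd (H.neg_root _ hdR) ?_ ?_ ?_ ?_).resolve_right fun hR => hd2 ?_
    · rw [show θ + y + -d = x + θ by rw [hy]; abel]; exact hx.2.2.1
    · rw [show y + -d = x by rw [hy]; abel]; exact H.ne_zero hxR
    · rw [add_comm]; exact add_ne_zero_of_outer' hθI hyo
    · rw [← sub_eq_add_neg, ← neg_sub, neg_ne_zero]; exact sub_ne_zero_of_outer hθI hdo
    · rw [← H.neg_root_iff]
      rwa [neg_sub, sub_eq_add_neg]
  rw [add_comm] at hyθ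
  have hya : a + y ∉ R := by
    intro hR
    have e : a + y = a + d + x := by rw [hy]; abel
    have hmem := C.inv.closed _ had.1 _ hx.1 (by rwa [← e])
    rw [← e] at hmem
    exact (C.bad_add hθ hθI ha hyo (Or.inl hmem)).2.1 hyθ
  have hax : a - x ∈ R := by
    rw [sub_eq_add_neg]
    refine (H.three haR hxd (H.neg_root _ hxR) ?_ ?_ ?_ ?_).resolve_left hya
    · rw [show a + y + -x = a + d by rw [hy]; abel]; exact hadR
    · rw [show y + -x = d by rw [hy]; abel]; exact H.ne_zero hdR
    · exact C.add_ne_zero_of_outer ha.1 hyo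
    · intro h0
      apply hyΦ
      rw [hy, ← (add_neg_eq_zero.1 h0)]
      exact had.1
  obtain ⟨r, hr⟩ : ∃ r, x = a + r := ⟨x - a, by abel⟩
  have hrR : r ∈ R := by
    rw [← H.neg_root_iff]
    rwa [show -r = a - x by rw [hr]; abel]
  have hro : r ∈ outer b R I Φ := by
    refine C.mem_outer_of_notMem hrR ?_ ?_ ?_
    · intro hrI
      apply hyΦ
      refine C.mem_of_sub_mem had.1 had.2.1 hxd ?_
      rwa [show y - (a + d) = r by rw [hy, hr]; abel]
    · intro hrΦ
      apply hyΦ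
      have e : a + d + r = y := by rw [hy, hr]; abel
      have := C.inv.closed _ had.1 _ hrΦ (by rwa [e])
      rwa [e] at this
    · intro hrΦ
      have e : a + d + -y = -r := by rw [hy, hr]; abel
      refine (C.bad_add hθ hθI had (neg_mem_outer hyo) (Or.inl (by rwa [e]))).2.2 ?_
      rw [show -y - θ = -(y + θ) by abel]
      exact H.neg_root _ hyθ
  obtain ⟨-, hr1, hr2⟩ := C.bad_add hθ hθI ha hro (Or.inl (by rw [← hr]; exact hx.1))
  have hZ : a + y + θ ∉ R := by
    intro hR
    have e : a + y + θ = a + d + (x + θ) := by rw [hy]; abel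
    have hmem := C.inv.closed _ had.1 _ hxθ (by rwa [← e])
    rw [← e, add_right_comm] at hmem
    refine (C.bad_add (H.neg_root _ hθ) (neg_mem hθI) (C.bad_neg hθI ha) hyo
      (Or.inl hmem)).2.2 ?_
    rwa [sub_neg_eq_add]
  have hZ0 : a + y + θ ≠ 0 := by
    rw [add_right_comm]
    exact C.add_ne_zero_of_outer haθ hyo
  have hdθ := C.inner_label hθ hθI hdo hd1 hd2
  have hrθ := C.inner_label hθ hθI hro hr1 hr2
  have i1 := H.inner_nonneg haR hyθ (by rwa [← add_assoc]) (by rwa [← add_assoc])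
  have i2 := H.inner_nonpos hadR ha.2.2.1 (by rwa [add_sub_add_left_eq_sub])
    (by rw [add_sub_add_left_eq_sub]; exact sub_ne_zero_of_outer hθI hdo)
  have i3 := H.inner_nonpos hxR ha.2.2.1 (by rwa [hr, add_sub_add_left_eq_sub])
    (by rw [hr, add_sub_add_left_eq_sub]; exact sub_ne_zero_of_outer hθI hro)
  have e4 : y - (a + d + θ) = r - θ := by rw [hy, hr]; abel
  have i4 := H.inner_nonpos hxd had.2.2.1 (by rwa [e4])
    (by rw [e4]; exact sub_ne_zero_of_outer hθI hro)
  have i5 := H.inner_self_pos (H.ne_zero hdR)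
  have eZ : a + d + (a + r + θ) = a + y + θ := by rw [hy, hr]; abel
  have i6 := H.inner_nonneg hadR (β := a + r + θ) (by rw [← hr]; exact hx.2.2.1) (by rwa [eZ])
    (by rwa [eZ])
  have ey : y = a + r + d := by rw [hy, hr]
  have hdr : inner ℝ d r < 0 := by
    rw [ey] at i1 i4
    rw [hr] at i3
    simp only [inner_add_left, inner_add_right, real_inner_comm a d, real_inner_comm a r,
      real_inner_comm d r, hdθ, hrθ] at i1 i2 i3 i4 i5 ⊢
    linarith
  have hdr0 : d + r ≠ 0 := by
    intro h0
    apply hyΦ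
    rw [ey, add_assoc, add_comm r d, h0, add_zero]
    exact ha.1
  have hdrR := H.add_root _ hdR _ hrR hdr hdr0
  have e7 : y - (a + θ) = -θ + d + r := by rw [ey]; abel
  have i7 := H.inner_nonpos hxd ha.2.2.1 (by
    rw [e7]
    intro hR
    rcases H.three (H.neg_root _ hθ) hdR hrR hR hdr0
      (by rw [neg_add_eq_sub]; exact sub_ne_zero_of_outer hθI hdo)
      (by rw [neg_add_eq_sub]; exact sub_ne_zero_of_outer hθI hro) with h | h
    · exact hd2 (by rwa [neg_add_eq_sub] at h)
    · exact hr2 (by rwa [neg_add_eq_sub] at h)) (by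
    intro h0
    exact hyΦ (by rw [sub_eq_zero.1 h0]; exact haθ))
  rw [ey] at i7
  simp only [inner_add_left, inner_add_right, real_inner_comm a d, real_inner_comm a r,
      hdθ, hrθ] at i6 i7 hdr
  linarith

/-- The elements of `outer` that are not labels. -/
def nonlabels (b : Basis κ ℝ V) (R : Set V) (I : Set κ) (Φ : Set V) (θ : V) : Set V :=
  outer b R I Φ \ labels b R I Φ θ

lemma neg_mem_nonlabels {θ d : V} (h : d ∈ nonlabels b R I Φ θ) : -d ∈ nonlabels b R I Φ θ :=
  ⟨neg_mem_outer h.1, fun h' => h.2 (by simpa using neg_mem_labels h')⟩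

lemma bad_subset_stab_nonlabels (C : IsInflatedInversionSet b R I Φ) {θ : V} (hθ : θ ∈ R)
    (hθI : θ ∈ Submodule.span ℝ (b '' I)) :
    bad b R I Φ θ ⊆ stab R (nonlabels b R I Φ θ) := by
  intro x hx
  refine ⟨(C.inv.subset hx.1).1, fun ζ hζ hR => ?_⟩
  have hζ' : ζ + x ∉ sym Φ := by
    intro h
    rw [add_comm] at h
    exact hζ.2 ⟨hζ.1, x, hx, (C.bad_add hθ hθI hx hζ.1 h).1⟩
  refine ⟨⟨(C.sym_or hR).resolve_left hζ', ?_⟩, fun hl => ?_⟩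
  · rw [add_comm]
    exact C.add_notMem_span hx.1 hx.2.1 hζ.1
  · have e : x + -(ζ + x) = -ζ := by abel
    have := C.add_mem_sym_of_label hθ hθI (neg_mem_labels hl) hx
      (by rw [e]; exact C.root.neg_root _ (C.sym_compl_subset hζ.1.1))
    rw [e, neg_mem_sym] at this
    exact C.notMem_sym_compl this hζ.1.1

lemma span_subset_stab_nonlabels (C : IsInflatedInversionSet b R I Φ) {θ γ : V} (hθ : θ ∈ R)
    (hθI : θ ∈ Submodule.span ℝ (b '' I)) (hγ : γ ∈ R)
    (hγI : γ ∈ Submodule.span ℝ (b '' I)) : γ ∈ stab R (nonlabels b R I Φ θ) := by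
  refine ⟨hγ, fun ζ hζ hR => ?_⟩
  have hζR := C.sym_compl_subset hζ.1.1
  refine ⟨C.mem_outer_of_sub_mem hζ.1 hR (by simpa using hγI), ?_⟩
  rintro ⟨hdo, x, hx, hxd⟩
  have h1 : x + ζ ∉ R := by
    intro hR'
    have : x + ζ ∈ Φ := C.mem_of_sub_mem hxd.1 hxd.2.1 hR' (by
      rw [show x + ζ - (x + (ζ + γ)) = -γ by abel]
      exact neg_mem hγI)
    exact hζ.2 ⟨hζ.1, x, hx, (C.bad_add hθ hθI hx hζ.1 (Or.inl this)).1⟩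
  have h2 : x + γ ∈ R := by
    refine (C.root.three (C.inv.subset hx.1).1 hζR hγ (by
      rw [add_assoc]; exact (C.inv.subset hxd.1).1) (C.root.ne_zero hR)
      (C.add_ne_zero_of_outer hx.1 hζ.1) ?_).resolve_left h1
    intro h0
    apply hx.2.1
    rw [eq_neg_of_add_eq_zero_left h0]
    exact neg_mem hγI
  have h3 : x + γ ∈ Φ := C.mem_of_sub_mem hx.1 hx.2.1 h2 (by simpa using hγI)
  have e : x + (ζ + γ) + -ζ = x + γ := by abel
  have h4 := (C.bad_add hθ hθI hxd (neg_mem_outer hζ.1) (Or.inl (by rwa [e]))).1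
  exact hζ.2 (by simpa using neg_mem_labels ⟨neg_mem_outer hζ.1, _, hxd, h4⟩)

end IsInflatedInversionSet

end Inflated

/-! ### Bad roots are co-closed -/

section CoClosed

variable {V κ : Type*} [SeminormedAddCommGroup V] [InnerProductSpace ℝ V]
variable {b : Basis κ ℝ V} {R : Set V} {I : Set κ} {Φ : Set V}

namespace IsInflatedInversionSet

/-- The roots of `Φ` outside `span I` that are not bad, but give a bad root when a suitable root of
`Φ` outside `span I` is added. -/
def summands (b : Basis κ ℝ V) (R : Set V) (I : Set κ) (Φ : Set V) (θ : V) : Set V :=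
  {z | z ∈ Φ ∧ z ∉ Submodule.span ℝ (b '' I) ∧ z ∉ bad b R I Φ θ ∧
    ∃ z' ∈ Φ, z' ∉ Submodule.span ℝ (b '' I) ∧ z + z' ∈ bad b R I Φ θ}

/-- A step from a summand `z` of the bad root `z + z'` either is absorbed by the bad root or is
subtracted from `z'`. -/
lemma summand_cases (C : IsInflatedInversionSet b R I Φ) {θ z z' δ : V} (hθ : θ ∈ R)
    (hθI : θ ∈ Submodule.span ℝ (b '' I)) (hz : z ∈ Φ)
    (hzb : z ∉ bad b R I Φ θ) (hz' : z' ∈ Φ) (hzI' : z' ∉ Submodule.span ℝ (b '' I))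
    (hα : z + z' ∈ bad b R I Φ θ) (hδ : δ ∈ outer b R I Φ) (hzδ : z + δ ∈ Φ) :
    z + δ ∉ bad b R I Φ θ ∧ (z + z' + δ ∈ bad b R I Φ θ ∨
      (z + z' + δ ∉ R ∧ z' - δ ∈ Φ ∧ z' - δ ∉ Submodule.span ℝ (b '' I))) := by
  have H := C.root
  have hδR := C.sym_compl_subset hδ.1
  have hzR := (C.inv.subset hz).1
  have hzR' := (C.inv.subset hz').1
  have hαR := (C.inv.subset hα.1).1
  have hnb : z + δ ∉ bad b R I Φ θ := by
    intro hb
    have e : z + δ + -δ = z := by abel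
    have := (C.bad_add hθ hθI hb (neg_mem_outer hδ) (Or.inl (by rwa [e]))).1
    rw [e] at this
    exact hzb this
  refine ⟨hnb, ?_⟩
  by_cases hR : z + z' + δ ∈ R
  · left
    have e : z + z' + δ = z + δ + z' := by abel
    have hmem := C.inv.closed _ hzδ _ hz' (by rwa [← e])
    rw [← e] at hmem
    exact (C.bad_add hθ hθI hα hδ (Or.inl hmem)).1
  right
  have h1 : δ + -z' ∈ R := by
    refine (H.three hδR hαR (H.neg_root _ hzR') ?_ ?_ ?_ ?_).resolve_left fun h => hR ?_
    · rw [show δ + (z + z') + -z' = z + δ by abel]; exact (C.inv.subset hzδ).1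
    · rw [add_neg_cancel_right]; exact H.ne_zero hzR
    · rw [add_comm]; exact C.add_ne_zero_of_outer hα.1 hδ
    · rw [show δ + -z' = -(z' + -δ) by abel, neg_ne_zero]
      exact C.add_ne_zero_of_outer hz' (neg_mem_outer hδ)
    · rwa [add_comm]
  have h2 : z' - δ ∈ R := by
    rw [← H.neg_root_iff]
    rwa [show -(z' - δ) = δ + -z' by abel]
  have h3 : z' - δ ∉ Submodule.span ℝ (b '' I) := by
    rw [sub_eq_add_neg]
    exact C.add_notMem_span hz' hzI' (neg_mem_outer hδ)
  refine ⟨hR, ?_, h3⟩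
  by_contra h4
  have h5 : -(z' - δ) ∉ Φ := by
    intro h
    have e : z' + -(z' - δ) = δ := by abel
    have := C.inv.closed _ hz' _ h (by rwa [e])
    rw [e] at this
    exact C.notMem_sym_compl (Or.inl this) hδ.1
  have h6 := neg_mem_outer (C.mem_outer_of_notMem h2 h3 h4 h5)
  have e : z + z' + -(z' - δ) = z + δ := by abel
  have := (C.bad_add hθ hθI hα h6 (Or.inl (by rwa [e]))).1
  rw [e] at this
  exact hnb this

/-- A step `δ` from a summand of a bad root leads to a summand of a bad root, and neither of `δ ± θ`
is a root, so that `δ` is orthogonal to `θ`. -/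
lemma step_of_mem_summands (C : IsInflatedInversionSet b R I Φ) {θ z δ : V} (hθ : θ ∈ R)
    (hθI : θ ∈ Submodule.span ℝ (b '' I)) (hz : z ∈ summands b R I Φ θ)
    (hδ : δ ∈ outer b R I Φ) (hzδ : z + δ ∈ Φ) :
    z + δ ∈ summands b R I Φ θ ∧ δ + θ ∉ R ∧ δ - θ ∉ R := by
  have H := C.root
  obtain ⟨hzΦ, hzI, hzb, z', hz', hzI', hα⟩ := hz
  have hδI := C.add_notMem_span hzΦ hzI hδ
  obtain ⟨hnb, hcase⟩ := C.summand_cases hθ hθI hzΦ hzb hz' hzI' hα hδ hzδ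
  rcases hcase with h | ⟨hR, h, hI⟩
  · refine ⟨⟨hzδ, hδI, hnb, z', hz', hzI', by rwa [add_right_comm]⟩, ?_⟩
    exact (C.bad_add hθ hθI hα hδ (Or.inl h.1)).2
  refine ⟨⟨hzδ, hδI, hnb, _, h, hI, by rwa [add_add_sub_cancel]⟩, ?_⟩
  have hδR := C.sym_compl_subset hδ.1
  have hαR := (C.inv.subset hα.1).1
  have hαθ := C.bad_neg hθI hα
  by_contra hcon
  have hcon' : δ + θ ∈ R ∨ -δ + θ ∈ R := by
    rw [not_and_or, not_not, not_not] at hcon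
    refine hcon.imp_right fun h => ?_
    rw [← H.neg_root_iff]
    rwa [show -(-δ + θ) = δ - θ by abel]
  -- neither `δ` nor `-δ` can be added to the bad root, since `δ ± θ` is a root
  have hnot : ∀ η ∈ outer b R I Φ, (η + θ ∈ R ∨ -η + θ ∈ R) → z + z' + η ∉ Φ := by
    intro η hη h' hmem
    obtain ⟨-, h1, h2⟩ := C.bad_add hθ hθI hα hη (Or.inl hmem)
    refine h'.elim h1 fun h3 => h2 ?_
    rw [← H.neg_root_iff]
    rwa [show -(η - θ) = -η + θ by abel]
  have hnotθ : ∀ η ∈ outer b R I Φ, η + θ ∈ R → z + z' + η + θ ∉ Φ := by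
    intro η hη h' hmem
    rw [add_right_comm] at hmem
    have h2 := (C.bad_add (H.neg_root _ hθ) (neg_mem hθI) hαθ hη (Or.inl hmem)).2.2
    rw [sub_neg_eq_add] at h2
    exact h2 h'
  -- a sum of two roots of `Φ` outside `span I` plus `θ` is in `Φ` if it is a root
  have hsum : ∀ u ∈ Φ, u ∉ Submodule.span ℝ (b '' I) → ∀ v ∈ Φ,
      v ∉ Submodule.span ℝ (b '' I) → u + v ≠ 0 → u + v + θ ∈ R → u + v + θ ∈ Φ := by
    intro u hu huI v hv hvI h0 hR
    have hne : ∀ w, w ∉ Submodule.span ℝ (b '' I) → θ + w ≠ 0 := by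
      intro w hw h0
      apply hw
      rw [eq_neg_of_add_eq_zero_right h0]
      exact neg_mem hθI
    have e : θ + u + v = u + v + θ := by abel
    rcases H.three hθ (C.inv.subset hu).1 (C.inv.subset hv).1 (by rwa [e]) h0 (hne u huI)
      (hne v hvI) with h | h
    · have := C.inv.closed _ (C.mem_of_sub_mem hu huI h (by simpa using hθI)) _ hv (by rwa [e])
      rwa [e] at this
    · have e : u + (θ + v) = u + v + θ := by abel
      have := C.inv.closed _ hu _ (C.mem_of_sub_mem hv hvI h (by simpa using hθI)) (by rwa [e])
      rwa [e] at this
  have hne1 := C.add_ne_zero_of_outer hα.1 hδ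
  have hne2 := C.add_ne_zero_of_outer hα.1 (neg_mem_outer hδ)
  have e1 : z + (z' - δ) = z + z' + -δ := by abel
  have hR' : z + z' + -δ ∉ R := by
    intro hR'
    have := C.inv.closed _ hzΦ _ h (by rwa [e1])
    rw [e1] at this
    exact hnot _ (neg_mem_outer hδ) (by rw [neg_neg]; exact hcon'.symm) this
  have e2 : z + δ + z' = z + z' + δ := by abel
  rcases hcon' with hc | hc
  · refine H.false_of_add_mem hαR hδR hθ hα.2.2.1 hc hR hne1 (by rwa [sub_eq_add_neg])
      (by rwa [sub_eq_add_neg]) (fun hR2 => hnotθ δ hδ hc ?_) ?_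
    · rw [← e2] at hR2 hne1 ⊢
      exact hsum _ hzδ hδI _ hz' hzI' hne1 hR2
    · rw [add_right_comm]
      exact C.add_ne_zero_of_outer hαθ.1 hδ
  · refine H.false_of_add_mem hαR (H.neg_root _ hδR) hθ hα.2.2.1 hc hR' hne2
      (by rwa [sub_neg_eq_add]) (by rwa [sub_neg_eq_add])
      (fun hR2 => hnotθ _ (neg_mem_outer hδ) hc ?_) ?_
    · rw [← e1] at hR2 hne2 ⊢
      exact hsum _ hzΦ hzI _ h hI hne2 hR2
    · rw [add_right_comm]
      exact C.add_ne_zero_of_outer hαθ.1 (neg_mem_outer hδ)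

/-- If `ζ + θ` is a root, then `ζ`, not being bad, is joined to it by a path, but the steps of this
path preserve the inner product with `θ`. -/
lemma notMem_summands (C : IsInflatedInversionSet b R I Φ) {θ ζ : V} (hθ : θ ∈ R)
    (hθI : θ ∈ Submodule.span ℝ (b '' I)) (hR : ζ + θ ∈ R) : ζ ∉ summands b R I Φ θ := by
  intro hζ
  have hl : Link b R I Φ ζ (ζ + θ) := by
    by_contra hl
    exact hζ.2.2.1 ⟨hζ.1, hζ.2.1, hR, hl⟩
  have key : ∀ y, Link b R I Φ ζ y → y ∈ summands b R I Φ θ ∧ inner ℝ y θ = inner ℝ ζ θ := by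
    intro y hy
    induction hy with
    | refl => exact ⟨hζ, rfl⟩
    | @tail x y _ h ih =>
      obtain ⟨hx, hy, hδ⟩ := h
      obtain ⟨δ, rfl⟩ : ∃ δ, y = x + δ := ⟨y - x, by abel⟩
      rw [add_sub_cancel_left] at hδ
      obtain ⟨h1, h2, h3⟩ := C.step_of_mem_summands hθ hθI ih.1 hδ hy
      refine ⟨h1, ?_⟩
      rw [inner_add_left, C.inner_label hθ hθI hδ h2 h3, add_zero, ih.2]
  have h1 := (key _ hl).2
  have h2 := C.root.inner_self_pos (C.root.ne_zero hθ)
  rw [inner_add_left] at h1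
  linarith

/-- If a bad root is the sum of two positive roots outside `span I`, then one of them is bad. -/
lemma bad_coclosed (C : IsInflatedInversionSet b R I Φ) {θ μ ν : V} (hθ : θ ∈ R)
    (hθI : θ ∈ Submodule.span ℝ (b '' I)) (hμ : μ ∈ pos R (Set.range b))
    (hμI : μ ∉ Submodule.span ℝ (b '' I)) (hν : ν ∈ pos R (Set.range b))
    (hνI : ν ∉ Submodule.span ℝ (b '' I)) (h : μ + ν ∈ bad b R I Φ θ) :
    μ ∈ bad b R I Φ θ ∨ ν ∈ bad b R I Φ θ := by
  have aux : ∀ μ ν : V, μ ∈ Φ → ν ∈ pos R (Set.range b) → ν ∉ Submodule.span ℝ (b '' I) →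
      μ + ν ∈ bad b R I Φ θ → ν ∉ Φ → μ ∈ bad b R I Φ θ := by
    intro μ ν hμ hν hνI h hνΦ
    have ho : -ν ∈ outer b R I Φ := neg_mem_outer ⟨Or.inl ⟨hν, hνΦ⟩, hνI⟩
    have := (C.bad_add hθ hθI h ho (by rw [add_neg_cancel_right]; exact Or.inl hμ)).1
    rwa [add_neg_cancel_right] at this
  by_cases hμΦ : μ ∈ Φ <;> by_cases hνΦ : ν ∈ Φ
  · by_contra hcon
    rw [not_or] at hcon
    rcases C.root.three hθ hμ.1 hν.1 (by rw [add_assoc, add_comm]; exact h.2.2.1)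
      (C.root.ne_zero (C.inv.subset h.1).1)
      (fun h0 => hμI (by rw [eq_neg_of_add_eq_zero_right h0]; exact neg_mem hθI))
      (fun h0 => hνI (by rw [eq_neg_of_add_eq_zero_right h0]; exact neg_mem hθI)) with hR | hR
    · exact C.notMem_summands hθ hθI (by rwa [add_comm])
        ⟨hμΦ, hμI, hcon.1, ν, hνΦ, hνI, h⟩
    · exact C.notMem_summands hθ hθI (by rwa [add_comm])
        ⟨hνΦ, hνI, hcon.2, μ, hμΦ, hμI, by rwa [add_comm]⟩
  · exact Or.inl (aux _ _ hμΦ hν hνI h hνΦ)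
  · exact Or.inr (aux _ _ hνΦ hμ hμI (by rwa [add_comm]) hμΦ)
  · exact absurd h.1 (C.inv.coclosed _ ⟨hμ, hμΦ⟩ _ ⟨hν, hνΦ⟩ (C.inv.subset h.1).1).2

end IsInflatedInversionSet

end CoClosed

/-! ### Inflations of primitive sets -/

section Primitive

variable {V κ : Type*} [SeminormedAddCommGroup V] [InnerProductSpace ℝ V]
variable {b : Basis κ ℝ V} {R : Set V} {I : Set κ} {Φ : Set V}

/-- The simple roots that occur in the elements of `X`. -/
def supp (b : Basis κ ℝ V) (X : Set V) : Set κ := {k | ∃ x ∈ X, b.repr x k ≠ 0}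

lemma subset_span_supp (X : Set V) : X ⊆ Submodule.span ℝ (b '' supp b X) := by
  intro x hx
  refine mem_span_iff.2 fun k hk => ?_
  by_contra h0
  exact hk ⟨x, hx, h0⟩

lemma supp_subset {X : Set V} {L : Set κ} (h : X ⊆ Submodule.span ℝ (b '' L)) :
    supp b X ⊆ L := by
  rintro k ⟨x, hx, h0⟩
  by_contra hk
  exact h0 (mem_span_iff.1 (h hx) k hk)

lemma subset_supp {X : Set V} {I : Set κ} (h : ∀ k ∈ I, b k ∈ X) : I ⊆ supp b X :=
  fun k hk => ⟨b k, h k hk, by simp⟩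

lemma span_mono_image {I K : Set κ} (h : I ⊆ K) :
    Submodule.span ℝ (b '' I) ≤ Submodule.span ℝ (b '' K) :=
  Submodule.span_mono (Set.image_mono h)

namespace IsInflatedInversionSet

variable [Fintype κ]

/-- If there are bad roots, and `Φ` is inflated from no set between `I` and the whole base, then no
`δ ± θ` with `δ ∈ ±Φᶜ` outside `span I` is a root. -/
lemma notMem_of_bad (C : IsInflatedInversionSet b R I Φ)
    (hconn : ∀ A : Set κ, A.Nonempty → (∀ i ∈ A, ∀ j, inner ℝ (b i) (b j) < 0 → j ∈ A) →
      A = Set.univ)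
    (prim : ∀ K, I ⊆ K → IsInflatedInversionSet b R K Φ → K = I ∨ K = Set.univ)
    {θ : V} (hθ : θ ∈ R) (hθI : θ ∈ Submodule.span ℝ (b '' I))
    (hbad : (bad b R I Φ θ).Nonempty) {δ : V} (hδ : δ ∈ outer b R I Φ) : θ + δ ∉ R := by
  have H := C.root
  set X : Set V := bad b R I Φ θ ∪ {γ | γ ∈ pos R (Set.range b) ∧
    γ ∈ Submodule.span ℝ (b '' I)} with hXdef
  have hXpos : X ⊆ pos R (Set.range b) := by
    rintro x (hx | hx)
    exacts [C.inv.subset hx.1, hx.1]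
  have hco : ∀ μ ∈ pos R (Set.range b), ∀ ν ∈ pos R (Set.range b), μ + ν ∈ X →
      μ ∈ X ∨ ν ∈ X := by
    intro μ hμ ν hν h
    by_cases hμI : μ ∈ Submodule.span ℝ (b '' I)
    · exact Or.inl (Or.inr ⟨hμ, hμI⟩)
    by_cases hνI : ν ∈ Submodule.span ℝ (b '' I)
    · exact Or.inr (Or.inr ⟨hν, hνI⟩)
    rcases h with h | h
    · exact (C.bad_coclosed hθ hθI hμ hμI hν hνI h).imp Or.inl Or.inl
    · exact absurd (H.mem_span_of_add hμ hν h.2) hμI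
  set K := supp b X with hK
  have hXK : X ⊆ Submodule.span ℝ (b '' K) := subset_span_supp X
  have hIK : I ⊆ K := subset_supp fun k hk =>
    Or.inr ⟨H.base_pos k, Submodule.subset_span ⟨k, hk, rfl⟩⟩
  have hIK' := span_mono_image (b := b) hIK
  -- `Φ` is inflated from the support of the bad roots, hence the support is everything
  have hKuniv : K = Set.univ := by
    set F : Set V := sym {x | x ∈ Φ ∧ x ∉ Submodule.span ℝ (b '' K)} with hF
    have hFR : F ⊆ R := by
      rintro x (hx | hx)
      exacts [(C.inv.subset hx.1).1, H.neg_root_iff.1 (C.inv.subset hx.1).1]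
    have hFneg : ∀ x ∈ F, -x ∈ F := fun x hx => neg_mem_sym.2 hx
    have hpm : ∀ γ ∈ R, γ ∈ Submodule.span ℝ (b '' K) →
        (∀ x ∈ Φ, x ∉ Submodule.span ℝ (b '' K) →
          (x + γ ∈ R → x + γ ∈ sym Φ) ∧ (x - γ ∈ R → x - γ ∈ sym Φ)) → γ ∈ stab R F := by
      intro γ hγ hγK h
      have hns : ∀ x, x ∉ Submodule.span ℝ (b '' K) → x + γ ∉ Submodule.span ℝ (b '' K) :=
        fun x hx => notMem_of_sub_mem hx (by simpa using hγK)
      have hsymF : ∀ x, x ∈ sym Φ → x ∉ Submodule.span ℝ (b '' K) → x ∈ F := by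
        rintro x (hx | hx) hxK
        · exact Or.inl ⟨hx, hxK⟩
        · exact Or.inr ⟨hx, fun h' => hxK (by simpa using neg_mem h')⟩
      refine ⟨hγ, ?_⟩
      rintro x (⟨hx, hxK⟩ | ⟨hx, hxK⟩) hR
      · exact hsymF _ ((h x hx hxK).1 hR) (hns x hxK)
      · have e : -x - γ = -(x + γ) := by abel
        have h1 := (h _ hx hxK).2 (by rw [e]; exact H.neg_root _ hR)
        rw [e, neg_mem_sym] at h1
        exact hsymF _ h1 (hns x fun h' => hxK (neg_mem h'))
    have hXF : X ⊆ stab R F := by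
      intro γ hγX
      refine hpm γ (hXpos hγX).1 (hXK hγX) fun x hx hxK => ?_
      have hxI : x ∉ Submodule.span ℝ (b '' I) := fun h => hxK (hIK' h)
      rcases hγX with hγ | ⟨hγ, hγI⟩
      · refine ⟨fun hR => Or.inl (C.inv.closed x hx γ hγ.1 hR), fun hR => ?_⟩
        -- otherwise `x` is reached from the bad root `γ` by the step `x - γ`
        refine (C.sym_or hR).resolve_right fun hc => hxK (hXK (Or.inl ?_))
        have ho : x - γ ∈ outer b R I Φ := ⟨hc, fun h => hxK (by
          simpa using add_mem (hIK' h) (hXK (Or.inl hγ)))⟩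
        have := (C.bad_add hθ hθI hγ ho (by rw [add_sub_cancel]; exact Or.inl hx)).1
        rwa [add_sub_cancel] at this
      · exact ⟨fun hR => Or.inl (C.mem_of_sub_mem hx hxI hR (by simpa using hγI)),
          fun hR => Or.inl (C.mem_of_sub_mem hx hxI hR (by simpa using hγI))⟩
    have hT := H.isClosedSymm_stab hFR hFneg
    have hKL := supp_subset (H.subset_span_of_coclosed hXpos hco hT hXF)
    have hinf : IsInflatedInversionSet b R K Φ := by
      refine ⟨H, C.inv, fun x hx hxK y hy hyx => ?_⟩
      have hyF : y ∈ F := by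
        refine H.mem_of_sub_mem_span (I := K) ?_ (C.inv.subset hx).1 hy.1 hxK
          (by rw [← neg_sub]; exact neg_mem hyx) (Or.inl ⟨hx, hxK⟩)
        rintro z hz k hk v (rfl | rfl) hR
        · exact (hKL hk).2 z hz hR
        · exact (hT.neg _ (hKL hk)).2 z hz hR
      rcases hyF with h | h
      · exact h.1
      · exact absurd hy (H.notMem_pos_of_neg (C.inv.subset h.1))
    refine (prim K hIK hinf).resolve_left fun h => ?_
    obtain ⟨x, hx⟩ := hbad
    exact hx.2.1 (h ▸ hXK (Or.inl hx))
  -- hence all simple roots stabilize the set of non-labels, which therefore is empty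
  have hMR : nonlabels b R I Φ θ ⊆ R := fun x hx => C.sym_compl_subset hx.1.1
  have hT := H.isClosedSymm_stab hMR fun x hx => neg_mem_nonlabels hx
  have hXM : X ⊆ stab R (nonlabels b R I Φ θ) := by
    rintro x (hx | hx)
    · exact C.bad_subset_stab_nonlabels hθ hθI hx
    · exact C.span_subset_stab_nonlabels hθ hθI hx.1.1 hx.2
  have hKL := supp_subset (H.subset_span_of_coclosed hXpos hco hT hXM)
  have hlabel : δ ∈ labels b R I Φ θ := by
    by_contra hn
    have hall := H.subset_of_stab hconn hMR (fun x hx => neg_mem_nonlabels hx)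
      ⟨δ, hδ, hn⟩ fun k => hKL (by rw [← hK, hKuniv]; trivial)
    obtain ⟨x, hx⟩ := hbad
    exact C.notMem_sym_compl (Or.inl hx.1) (hall (C.inv.subset hx.1).1).1.1
  obtain ⟨-, x, hx, hxδ⟩ := hlabel
  rw [add_comm]
  exact (C.bad_add hθ hθI hx hδ (Or.inl hxδ.1)).2.1

/-- If `Φ` is the inflation from `I` of a primitive set, then congruent roots of `Φ` outside
`span I` whose difference is a root are joined by a path. -/
lemma link_of_primitive (C : IsInflatedInversionSet b R I Φ)
    (hconn : ∀ A : Set κ, A.Nonempty → (∀ i ∈ A, ∀ j, inner ℝ (b i) (b j) < 0 → j ∈ A) →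
      A = Set.univ)
    (prim : ∀ K, I ⊆ K → IsInflatedInversionSet b R K Φ → K = I ∨ K = Set.univ)
    (hout : (compl b R Φ \ Submodule.span ℝ (b '' I)).Nonempty)
    {θ α : V} (hθ : θ ∈ R) (hθI : θ ∈ Submodule.span ℝ (b '' I)) (hα : α ∈ Φ)
    (hαI : α ∉ Submodule.span ℝ (b '' I)) (hαθ : α + θ ∈ R) :
    Link b R I Φ α (α + θ) := by
  by_contra hl
  have H := C.root
  set F : Set V := {γ | γ ∈ R ∧ γ ∈ Submodule.span ℝ (b '' I) ∧
    ∀ δ ∈ outer b R I Φ, γ + δ ∉ R} with hF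
  have hFR : F ⊆ R := fun x hx => hx.1
  have hFneg : ∀ x ∈ F, -x ∈ F := by
    refine fun x hx => ⟨H.neg_root _ hx.1, neg_mem hx.2.1, fun δ hδ hR => ?_⟩
    refine hx.2.2 _ (neg_mem_outer hδ) ?_
    rw [← H.neg_root_iff]
    rwa [show -(x + -δ) = -x + δ by abel]
  have hθF : θ ∈ F := ⟨hθ, hθI, fun δ hδ => C.notMem_of_bad hconn prim hθ hθI
    ⟨α, hα, hαI, hαθ, hl⟩ hδ⟩
  have hstab : ∀ γ ∈ R, γ ∈ Submodule.span ℝ (b '' I) → γ ∈ stab R F := by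
    refine fun γ hγ hγI => ⟨hγ, fun x hx hR => ⟨hR, add_mem hx.2.1 hγI, fun η hη hR2 => ?_⟩⟩
    have hηR := C.sym_compl_subset hη.1
    rcases H.three hηR hx.1 hγ (by rwa [add_assoc, add_comm]) (H.ne_zero hR)
      (add_ne_zero_of_outer' hx.2.1 hη) (add_ne_zero_of_outer' hγI hη) with h | h
    · exact hx.2.2 η hη (by rwa [add_comm])
    · refine hx.2.2 _ (C.mem_outer_of_sub_mem hη h (by simpa using hγI)) ?_
      rwa [show x + (η + γ) = x + γ + η by abel]
  set X : Set V := compl b R Φ ∪ {γ | γ ∈ pos R (Set.range b) ∧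
    γ ∈ Submodule.span ℝ (b '' I)} with hXdef
  have hXpos : X ⊆ pos R (Set.range b) := by
    rintro x (hx | hx)
    exacts [hx.1, hx.1]
  have hco : ∀ μ ∈ pos R (Set.range b), ∀ ν ∈ pos R (Set.range b), μ + ν ∈ X →
      μ ∈ X ∨ ν ∈ X := by
    rintro μ hμ ν hν (h | h)
    · by_cases hμΦ : μ ∈ Φ
      · refine Or.inr (Or.inl ⟨hν, fun hνΦ => h.2 ?_⟩)
        exact C.inv.closed _ hμΦ _ hνΦ h.1.1
      · exact Or.inl (Or.inl ⟨hμ, hμΦ⟩)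
    · exact Or.inl (Or.inr ⟨hμ, H.mem_span_of_add hμ hν h.2⟩)
  have hXF : X ⊆ stab R F := by
    rintro δ (hδ | hδ)
    · by_cases hδI : δ ∈ Submodule.span ℝ (b '' I)
      · exact hstab δ hδ.1.1 hδI
      · exact ⟨hδ.1.1, fun x hx hR => absurd hR (hx.2.2 δ ⟨Or.inl hδ, hδI⟩)⟩
    · exact hstab δ hδ.1.1 hδ.2
  have hXK : X ⊆ Submodule.span ℝ (b '' supp b X) := subset_span_supp X
  have hIK : I ⊆ supp b X := subset_supp fun k hk =>
    Or.inr ⟨H.base_pos k, Submodule.subset_span ⟨k, hk, rfl⟩⟩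
  have hinf : IsInflatedInversionSet b R (supp b X) Φ := by
    refine ⟨H, C.inv, fun x hx hxK y hy hyx => ?_⟩
    by_contra hyΦ
    exact notMem_of_sub_mem hxK hyx (hXK (Or.inl ⟨hy, hyΦ⟩))
  have hKuniv := (prim _ hIK hinf).resolve_left fun h => by
    obtain ⟨x, hx, hxI⟩ := hout
    exact hxI (h ▸ hXK (Or.inl hx))
  have hKL := supp_subset (H.subset_span_of_coclosed hXpos hco (H.isClosedSymm_stab hFR hFneg) hXF)
  have hall := H.subset_of_stab hconn hFR hFneg ⟨θ, hθF⟩ fun k => hKL (by rw [hKuniv]; trivial)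
  exact hαI (hall (C.inv.subset hα).1).2.1

/-! ### Sets that are stable under the edges of the graph -/

/-- Suppose that `Φ` contains all positive roots outside `span I` and that `I` is least with this
property. A subset `D` of `Φ` is inflated from `I` if it is stable under the steps in `±Φᶜ`. -/
lemma mem_of_full (H : IsRootSystem b R) (hinv : IsInversionSet R (Set.range b) Φ)
    (hfull : compl b R Φ ⊆ Submodule.span ℝ (b '' I))
    (hleast : ∀ K, compl b R Φ ⊆ Submodule.span ℝ (b '' K) → I ⊆ K)
    {D : Set V} (hD : D ⊆ Φ)
    (hstep : ∀ x ∈ D, ∀ y ∈ Φ, y - x ∈ sym (compl b R Φ) → y ∈ D)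
    {x y : V} (hx : x ∈ D) (hxI : x ∉ Submodule.span ℝ (b '' I))
    (hy : y ∈ pos R (Set.range b)) (hyx : y - x ∈ Submodule.span ℝ (b '' I)) : y ∈ D := by
  set F : Set V := sym {x | x ∈ D ∧ x ∉ Submodule.span ℝ (b '' I)} with hF
  have hFR : F ⊆ R := by
    rintro x (hx | hx)
    exacts [(hinv.subset (hD hx.1)).1, H.neg_root_iff.1 (hinv.subset (hD hx.1)).1]
  have hT := H.isClosedSymm_stab hFR fun x hx => neg_mem_sym.2 hx
  have hplus : ∀ x ∈ D, x ∉ Submodule.span ℝ (b '' I) → ∀ δ ∈ sym (compl b R Φ),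
      δ ∈ Submodule.span ℝ (b '' I) → x + δ ∈ R →
      x + δ ∈ D ∧ x + δ ∉ Submodule.span ℝ (b '' I) := by
    intro x hx hxI δ hδ hδI hR
    have h1 := IsInflatedInversionSet.notMem_of_sub_mem (b := b) hxI
      (y := x + δ) (by simpa using hδI)
    have h2 := H.mem_pos_of_sub_mem (hinv.subset (hD hx)) hxI hR (by simpa using hδI)
    have h3 : x + δ ∈ Φ := by
      by_contra h3
      exact h1 (hfull ⟨h2, h3⟩)
    exact ⟨hstep x hx _ h3 (by simpa using hδ), h1⟩
  have hXF : compl b R Φ ⊆ stab R F := by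
    refine fun δ hδ => ⟨hδ.1.1, ?_⟩
    rintro x (⟨hx, hxI⟩ | ⟨hx, hxI⟩) hR
    · exact Or.inl (hplus x hx hxI δ (Or.inl hδ) (hfull hδ) hR)
    · right
      have e : -(x + δ) = -x + -δ := by abel
      have hR' := H.neg_root _ hR
      rw [Set.mem_ofPred_eq, e]
      rw [e] at hR'
      exact hplus _ hx hxI _ (neg_mem_sym.2 (Or.inl hδ)) (neg_mem (hfull hδ)) hR'
  have hIL := hleast _ (H.subset_span_of_coclosed (fun x hx => hx.1) (fun μ hμ ν hν h => by
    by_cases hμΦ : μ ∈ Φ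
    · exact Or.inr ⟨hν, fun hνΦ => h.2 (hinv.closed _ hμΦ _ hνΦ h.1.1)⟩
    · exact Or.inl ⟨hμ, hμΦ⟩) hT hXF)
  have hyF : y ∈ F := by
    refine H.mem_of_sub_mem_span (I := I) ?_ (hinv.subset (hD hx)).1 hy.1 hxI
      (by rw [← neg_sub]; exact neg_mem hyx) (Or.inl ⟨hx, hxI⟩)
    rintro z hz k hk v (rfl | rfl) hR
    · exact (hIL hk).2 z hz hR
    · exact (hT.neg _ (hIL hk)).2 z hz hR
  rcases hyF with h | h
  · exact h.1
  · exact absurd hy (H.notMem_pos_of_neg (hinv.subset (hD h.1)))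

/-- The counterpart of `mem_of_full` when `Φ` is the inflation of a primitive set. -/
lemma mem_of_primitive (C : IsInflatedInversionSet b R I Φ)
    (hconn : ∀ A : Set κ, A.Nonempty → (∀ i ∈ A, ∀ j, inner ℝ (b i) (b j) < 0 → j ∈ A) →
      A = Set.univ)
    (prim : ∀ K, I ⊆ K → IsInflatedInversionSet b R K Φ → K = I ∨ K = Set.univ)
    (hout : (compl b R Φ \ Submodule.span ℝ (b '' I)).Nonempty)
    {D : Set V} (hD : D ⊆ Φ)
    (hstep : ∀ x ∈ D, ∀ y ∈ Φ, y - x ∈ sym (compl b R Φ) → y ∈ D)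
    {x y : V} (hx : x ∈ D) (hxI : x ∉ Submodule.span ℝ (b '' I))
    (hy : y ∈ pos R (Set.range b)) (hyx : y - x ∈ Submodule.span ℝ (b '' I)) : y ∈ D := by
  have hlink : ∀ x y, Link b R I Φ x y → x ∈ D → y ∈ D := by
    intro x y h hx
    induction h with
    | refl => exact hx
    | tail _ h ih => exact hstep _ ih _ h.2.1 h.2.2.1
  have hyF := C.root.mem_of_sub_mem_span (I := I)
    (F := {x | x ∈ D ∧ x ∉ Submodule.span ℝ (b '' I)}) ?_ (C.inv.subset (hD hx)).1 hy.1 hxI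
      (by rw [← neg_sub]; exact neg_mem hyx) ⟨hx, hxI⟩
  · exact hyF.1
  intro z hz k hk v hv hR
  have hvI : v ∈ Submodule.span ℝ (b '' I) := by
    have : b k ∈ Submodule.span ℝ (b '' I) := Submodule.subset_span ⟨k, hk, rfl⟩
    rcases hv with rfl | rfl
    exacts [this, neg_mem this]
  have hvR : v ∈ R := by
    rcases hv with rfl | rfl
    exacts [C.root.base_root k, C.root.neg_root _ (C.root.base_root k)]
  exact ⟨hlink _ _ (C.link_of_primitive hconn prim hout hvR hvI (hD hz.1) hz.2 hR) hz.1,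
    notMem_of_sub_mem hz.2 (by simpa using hvI)⟩

end IsInflatedInversionSet

end Primitive

/-! ### Inflations and fibres of projections -/

section Fibres

variable {V : Type*} [AddCommGroup V] [Module ℝ V] {R S I C : Set V}

lemma proj_eq_zero {x : V} : proj I x = 0 ↔ x ∈ Submodule.span ℝ I := by
  rw [proj, Submodule.mkQ_apply, Submodule.Quotient.mk_eq_zero]

lemma proj_eq_proj {x y : V} : proj I x = proj I y ↔ x - y ∈ Submodule.span ℝ I := by
  rw [← proj_eq_zero, map_sub, sub_eq_zero]

lemma proj_mem_closure {x : V} (hx : x ∈ AddSubmonoid.closure S) :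
    proj I x ∈ AddSubmonoid.closure (quotBase S I) := by
  refine AddSubmonoid.closure_induction (motive := fun y _ => proj I y ∈ AddSubmonoid.closure
    (quotBase S I)) (fun s hs => ?_) (by simp) (fun x y _ _ h1 h2 => ?_) hx
  · by_cases hsI : s ∈ I
    · rw [proj_eq_zero.2 (Submodule.subset_span hsI)]
      exact zero_mem _
    · exact AddSubmonoid.subset_closure ⟨s, ⟨hs, hsI⟩, rfl⟩
  · rw [map_add]
    exact add_mem h1 h2

lemma proj_mem_pos {x : V} (hx : x ∈ pos R S) (hxI : x ∉ Submodule.span ℝ I) :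
    proj I x ∈ pos (quotRoots R I) (quotBase S I) :=
  ⟨⟨fun h => hxI (proj_eq_zero.1 h), x, hx.1, rfl⟩, proj_mem_closure hx.2⟩

/-- Inflated sets are those whose part outside `span I` is a union of fibres. -/
lemma mem_gen_of_fibre (hI : I ⊆ S) (hC : C ⊆ pos R S)
    (h : ∀ x ∈ C, x ∉ Submodule.span ℝ I → ∀ y ∈ pos R S, y - x ∈ Submodule.span ℝ I → y ∈ C) :
    I ∈ gen R S C := by
  refine ⟨proj I '' (C \ Submodule.span ℝ I), C ∩ Submodule.span ℝ I, hI, ?_,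
    fun x hx => ⟨hC hx.1, hx.2⟩, ?_⟩
  · rintro _ ⟨x, ⟨hx, hxI⟩, rfl⟩
    exact proj_mem_pos (hC hx) hxI
  · ext x
    constructor
    · intro hx
      by_cases hxI : x ∈ Submodule.span ℝ I
      · exact Or.inr ⟨hx, hxI⟩
      · exact Or.inl ⟨hC hx, x, ⟨hx, hxI⟩, rfl⟩
    · rintro (⟨hx, y, ⟨hy, hyI⟩, hyx⟩ | hx)
      · exact h y hy hyI x hx (proj_eq_proj.1 hyx.symm)
      · exact hx.1

lemma IsInflation.proj_mem {Φ X : Set V} {Ψ : Set (V ⧸ Submodule.span ℝ I)}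
    (h : IsInflation R S I Φ Ψ X) {x : V} (hx : x ∈ Φ) (hxI : x ∉ Submodule.span ℝ I) :
    proj I x ∈ Ψ := by
  rw [h.eq] at hx
  exact hx.elim (fun h => h.2) fun hx => absurd (h.subset_zero hx).2 hxI

lemma IsInflation.mem {Φ X : Set V} {Ψ : Set (V ⧸ Submodule.span ℝ I)}
    (h : IsInflation R S I Φ Ψ X) {x : V} (hx : x ∈ pos R S) (hxΨ : proj I x ∈ Ψ) : x ∈ Φ := by
  rw [h.eq]
  exact Or.inl ⟨hx, hxΨ⟩

lemma IsInflation.fibre {Φ X : Set V} {Ψ : Set (V ⧸ Submodule.span ℝ I)}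
    (h : IsInflation R S I Φ Ψ X) : ∀ x ∈ Φ, x ∉ Submodule.span ℝ I → ∀ y ∈ pos R S,
    y - x ∈ Submodule.span ℝ I → y ∈ Φ :=
  fun x hx hxI y hy hyx => h.mem hy (by rw [proj_eq_proj.2 hyx]; exact h.proj_mem hx hxI)

end Fibres

section Canonical

variable {V κ : Type*} [SeminormedAddCommGroup V] [InnerProductSpace ℝ V]
variable {b : Basis κ ℝ V} {R : Set V} {Φ : Set V}

lemma IsRootSystem.exists_pos_of_mem_pos (H : IsRootSystem b R) {I : Set κ}
    {u : V ⧸ Submodule.span ℝ (b '' I)}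
    (hu : u ∈ pos (quotRoots R (b '' I)) (quotBase (Set.range b) (b '' I))) :
    ∃ α ∈ pos R (Set.range b), α ∉ Submodule.span ℝ (b '' I) ∧ proj (b '' I) α = u := by
  obtain ⟨⟨hu0, α, hα, rfl⟩, hc⟩ := hu
  have hαI : α ∉ Submodule.span ℝ (b '' I) := fun h => hu0 (proj_eq_zero.2 h)
  refine ⟨α, (H.pos_or_neg_pos hα).resolve_right fun hn => hαI ?_, hαI, rfl⟩
  obtain ⟨c, hc0, hcα⟩ : ∃ c : V, (∀ k, 0 ≤ b.repr c k) ∧ proj (b '' I) c = proj (b '' I) α := by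
    refine AddSubmonoid.closure_induction (motive := fun y _ => ∃ c : V, (∀ k, 0 ≤ b.repr c k) ∧
      proj (b '' I) c = y) ?_ ⟨0, by simp, by simp⟩ ?_ hc
    · rintro _ ⟨_, ⟨⟨k, rfl⟩, -⟩, rfl⟩
      refine ⟨b k, fun j => ?_, rfl⟩
      rw [Basis.repr_self]
      by_cases h : k = j
      · simp [h]
      · simp [Finsupp.single_eq_of_ne (Ne.symm h)]
    · rintro _ _ - - ⟨c, hc, rfl⟩ ⟨d, hd, rfl⟩
      refine ⟨c + d, fun k => ?_, map_add _ _ _⟩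
      rw [map_add, Finsupp.add_apply]
      exact add_nonneg (hc k) (hd k)
  refine mem_span_iff.2 fun k hk => ?_
  have h1 := mem_span_iff.1 (proj_eq_proj.1 hcα) k hk
  have h2 := ((H.pos_iff _).1 hn).2 k
  have h3 := hc0 k
  rw [map_sub, Finsupp.sub_apply] at h1
  rw [map_neg, Finsupp.neg_apply] at h2
  linarith

/-- If `Φ` is the inflation of a primitive set from `I`, then there is no set strictly between `I`
and the whole base from which `Φ` is inflated. -/
lemma eq_or_eq_univ_of_isPrimitive {I K : Set κ} {X : Set V}
    {Ψ : Set (V ⧸ Submodule.span ℝ (b '' I))}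
    (hinf : IsInflation R (Set.range b) (b '' I) Φ Ψ X)
    (hprim : IsPrimitive (quotRoots R (b '' I)) (quotBase (Set.range b) (b '' I)) Ψ)
    (hIK : I ⊆ K) (C : IsInflatedInversionSet b R K Φ) : K = I ∨ K = Set.univ := by
  have H := C.root
  set I' : Set (V ⧸ Submodule.span ℝ (b '' I)) := proj (b '' I) '' (b '' K \ b '' I) with hI'
  have hI'S : I' ⊆ quotBase (Set.range b) (b '' I) := by
    rintro _ ⟨x, ⟨⟨k, -, rfl⟩, hxI⟩, rfl⟩
    exact ⟨b k, ⟨⟨k, rfl⟩, hxI⟩, rfl⟩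
  have hspan : ∀ x, proj (b '' I) x ∈ Submodule.span ℝ I' ↔ x ∈ Submodule.span ℝ (b '' K) := by
    intro x
    constructor
    · intro h
      rw [hI', Submodule.span_image] at h
      obtain ⟨y, hy, hyx⟩ := h
      have h1 := span_mono_image (b := b) hIK (proj_eq_proj.1 hyx)
      have h2 := Submodule.span_mono (R := ℝ) Set.sdiff_subset hy
      simpa using sub_mem h2 h1
    · intro h
      have h1 := Submodule.mem_map_of_mem (f := proj (b '' I)) h
      rw [← Submodule.span_image] at h1
      refine Submodule.span_le.2 ?_ h1
      rintro _ ⟨y, hy, rfl⟩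
      by_cases hyI : y ∈ b '' I
      · rw [proj_eq_zero.2 (Submodule.subset_span hyI)]
        exact zero_mem _
      · exact Submodule.subset_span ⟨y, ⟨hy, hyI⟩, rfl⟩
  obtain ⟨Ψ', X', h'⟩ := mem_gen_of_fibre hI'S hprim.subset (by
    intro u hu huI v hv hvu
    obtain ⟨x, hx, hxI, rfl⟩ := H.exists_pos_of_mem_pos (hprim.subset hu)
    obtain ⟨y, hy, hyI, rfl⟩ := H.exists_pos_of_mem_pos hv
    rw [← map_sub, hspan] at hvu
    rw [hspan] at huI
    exact hinf.proj_mem (C.fibre x (hinf.mem hx hu) huI y hy hvu) hyI)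
  refine (hprim.eq_or_eq _ _ _ h').imp (fun h => ?_) fun h => ?_
  · refine Set.Subset.antisymm (fun k hk => ?_) hIK
    by_contra hkI
    have : proj (b '' I) (b k) ∈ I' :=
      ⟨b k, ⟨⟨k, hk, rfl⟩, fun h => hkI (b.injective.mem_set_image.1 h)⟩, rfl⟩
    rw [h] at this
    exact this
  · refine Set.eq_univ_of_forall fun k => ?_
    by_contra hkK
    have hkI : b k ∉ b '' I := fun h => hkK (hIK (b.injective.mem_set_image.1 h))
    have : proj (b '' I) (b k) ∈ I' := by
      rw [h]
      exact ⟨b k, ⟨⟨k, rfl⟩, hkI⟩, rfl⟩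
    have := (hspan _).1 (Submodule.subset_span this)
    exact hkK (b.self_mem_span_image.1 this)

variable [Fintype κ]

/-- If `Φ` is canonically inflated from `I`, then the subsets of `Φ` that are stable under the edges
of the graph are inflated from `I`. -/
lemma IsRootSystem.mem_gen_of_step (H : IsRootSystem b R)
    (hconn : ∀ A : Set κ, A.Nonempty → (∀ i ∈ A, ∀ j, inner ℝ (b i) (b j) < 0 → j ∈ A) →
      A = Set.univ)
    (hΦ : IsInversionSet R (Set.range b) Φ) {I : Set V}
    (hI : IsCanonicallyInflated R (Set.range b) I Φ) {D : Set V} (hD : D ⊆ Φ)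
    (hstep : ∀ x ∈ D, ∀ y ∈ Φ, y - x ∈ sym (pos R (Set.range b) \ Φ) → y ∈ D) :
    I ∈ gen R (Set.range b) D := by
  obtain ⟨Ψ, X, hinf, -, hcases⟩ := hI
  obtain ⟨I, rfl⟩ : ∃ I₀ : Set κ, I = b '' I₀ :=
    ⟨b ⁻¹' I, (Set.image_preimage_eq_of_subset hinf.subset_base).symm⟩
  have C : IsInflatedInversionSet b R I Φ := ⟨H, hΦ, hinf.fibre⟩
  refine mem_gen_of_fibre hinf.subset_base (hD.trans hΦ.subset) fun x hx hxI y hy hyx => ?_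
  rcases hcases with hprim | ⟨rfl, -⟩ | ⟨rfl, hleast⟩
  · refine C.mem_of_primitive hconn (fun K hIK hK => eq_or_eq_univ_of_isPrimitive hinf hprim hIK hK)
      ?_ hD hstep hx hxI hy hyx
    obtain ⟨u, hu, huΨ⟩ := Set.exists_of_ssubset (hprim.subset.ssubset_of_ne hprim.ne_pos)
    obtain ⟨z, hz, hzI, rfl⟩ := H.exists_pos_of_mem_pos hu
    exact ⟨z, ⟨hz, fun hzΦ => huΨ (hinf.proj_mem hzΦ hzI)⟩, hzI⟩
  · exact absurd (hinf.proj_mem (hD hx) hxI) (Set.notMem_empty _)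
  · refine IsInflatedInversionSet.mem_of_full H hΦ (fun z hz => ?_) (fun K hK => ?_) hD hstep hx hxI
      hy hyx
    · by_contra hzI
      exact hz.2 (hinf.mem hz.1 (proj_mem_pos hz.1 hzI))
    · have : b '' I ⊆ b '' K := by
        refine hleast.2 ⟨Φ ∩ Submodule.span ℝ (b '' K), Set.image_subset_range _ _, subset_rfl,
          fun z hz => ⟨hΦ.subset hz.1, hz.2⟩, ?_⟩
        ext z
        constructor
        · intro hz
          by_cases hzK : z ∈ Submodule.span ℝ (b '' K)
          · exact Or.inr ⟨hz, hzK⟩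
          · exact Or.inl ⟨hΦ.subset hz, proj_mem_pos (hΦ.subset hz) hzK⟩
        · rintro (⟨hz, hzK⟩ | hz)
          · by_contra hzΦ
            exact hzK.1.1 (proj_eq_zero.2 (hK ⟨hz, hzΦ⟩))
          · exact hz.1
      exact (Set.image_subset_image_iff b.injective).1 this

/-- Both assertions for root systems in the sense of `IsRootSystem`, which include the quotient root
systems `Δ / J` by `isRootSystem_quotRoots`. -/
theorem IsRootSystem.components_and_decompositions_mem_gen (H : IsRootSystem b R)
    (hconn : ∀ A : Set κ, A.Nonempty → (∀ i ∈ A, ∀ j, inner ℝ (b i) (b j) < 0 → j ∈ A) →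
      A = Set.univ)
    (hΦ : IsInversionSet R (Set.range b) Φ) {I : Set V}
    (hI : IsCanonicallyInflated R (Set.range b) I Φ) :
    (∀ C, IsComponent Φ (pos R (Set.range b) \ Φ) C → I ∈ gen R (Set.range b) C) ∧
    (∀ Φ₁ Φ₂, IsInversionSet R (Set.range b) Φ₁ → IsInversionSet R (Set.range b) Φ₂ →
      Disjoint Φ₁ Φ₂ → Φ = Φ₁ ∪ Φ₂ →
      I ∈ gen R (Set.range b) Φ₁ ∧ I ∈ gen R (Set.range b) Φ₂) := by
  constructor
  · rintro _ ⟨c, rfl⟩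
    refine H.mem_gen_of_step hconn hΦ hI (by rintro _ ⟨x, -, rfl⟩; exact x.2) ?_
    rintro _ ⟨x, hx, rfl⟩ y hy hyx
    refine ⟨⟨y, hy⟩, ?_, rfl⟩
    have hadj : (graph Φ (pos R (Set.range b) \ Φ)).Adj x ⟨y, hy⟩ := by
      rw [graph, SimpleGraph.fromRel_adj]
      refine ⟨?_, ?_⟩
      · rintro rfl
        rw [sub_self] at hyx
        exact H.zero_notMem (hyx.elim (fun h => h.1.1) fun h => by simpa using h.1.1)
      · rcases hyx with h | h
        · exact Or.inr h
        · exact Or.inl (by rwa [neg_sub] at h)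
    rw [SimpleGraph.ConnectedComponent.mem_supp_iff] at hx ⊢
    rw [← hx]
    exact SimpleGraph.ConnectedComponent.sound hadj.symm.reachable
  · intro Φ₁ Φ₂ h₁ h₂ hdisj hun
    have aux : ∀ Φ₁ Φ₂ : Set V, IsInversionSet R (Set.range b) Φ₁ →
        IsInversionSet R (Set.range b) Φ₂ → Disjoint Φ₁ Φ₂ → Φ = Φ₁ ∪ Φ₂ →
        I ∈ gen R (Set.range b) Φ₁ := by
      intro Φ₁ Φ₂ h₁ h₂ hdisj hun
      refine H.mem_gen_of_step hconn hΦ hI (hun ▸ Set.subset_union_left) ?_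
      intro x hx y hy hyx
      by_contra hy₁
      have hy₂ : y ∈ Φ₂ := by
        rw [hun] at hy
        exact hy.resolve_left hy₁
      have hx₂ := Set.disjoint_left.1 hdisj hx
      -- the difference lies in neither of `Φ₁`, `Φ₂`, and both are co-closed
      rcases hyx with h | h
      · have h' : y - x ∉ Φ₂ := fun h' => h.2 (hun ▸ Or.inr h')
        have := h₂.coclosed x ⟨h₁.subset hx, hx₂⟩ _ ⟨h.1, h'⟩
          (by rw [add_sub_cancel]; exact (h₂.subset hy₂).1)
        rw [add_sub_cancel] at this
        exact this.2 hy₂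
      · rw [neg_sub] at h
        have h' : x - y ∉ Φ₁ := fun h' => h.2 (hun ▸ Or.inl h')
        have := h₁.coclosed y ⟨h₂.subset hy₂, hy₁⟩ _ ⟨h.1, h'⟩
          (by rw [add_sub_cancel]; exact (h₁.subset hx).1)
        rw [add_sub_cancel] at this
        exact this.2 hx
    exact ⟨aux Φ₁ Φ₂ h₁ h₂ hdisj hun,
      aux Φ₂ Φ₁ h₂ h₁ hdisj.symm (by rw [hun, Set.union_comm])⟩

end Canonical

/-! ### Quotients of crystallographic root systems -/

section Quotient

lemma forall_eq_univ_of_connected {V κ : Type*} [SeminormedAddCommGroup V] [InnerProductSpace ℝ V]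
    (b : Basis κ ℝ V) (h : (adjacencyDiagram (Set.range b)).Connected) (A : Set κ)
    (hne : A.Nonempty) (hA : ∀ i ∈ A, ∀ j, inner ℝ (b i) (b j) < 0 → j ∈ A) : A = Set.univ := by
  obtain ⟨i, hi⟩ := hne
  refine Set.eq_univ_of_forall fun j => ?_
  have key : ∀ t, (adjacencyDiagram (Set.range b)).Reachable ⟨b i, i, rfl⟩ t →
      (t : V) ∈ b '' A := by
    rintro t ⟨w⟩
    have : ∀ s t (_ : (adjacencyDiagram (Set.range b)).Walk s t), (s : V) ∈ b '' A →
        (t : V) ∈ b '' A := by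
      intro s t w
      induction w with
      | nil => exact id
      | @cons u v _ hadj _ ih =>
        rintro ⟨k, hk, hku⟩
        obtain ⟨_, ⟨l, rfl⟩⟩ := v
        refine ih ⟨l, hA k hk l ?_, rfl⟩
        rw [adjacencyDiagram, SimpleGraph.fromRel_adj, real_inner_comm, or_self] at hadj
        rw [hku]
        simpa only [real_inner_comm] using hadj.2
    exact this _ _ w ⟨i, hi, rfl⟩
  exact b.injective.mem_set_image.1 (key ⟨b j, j, rfl⟩ (h.preconnected _ _))

variable {E : Type*} [NormedAddCommGroup E] [InnerProductSpace ℝ E]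
variable {ι N : Type*} [AddCommGroup N] [Module ℝ N] {P : RootPairing ι ℝ E N}

lemma pairing_mul_inner
    (hP : ∀ (i : ι) (x y : E), inner ℝ (P.reflection i x) (P.reflection i y) = inner ℝ x y)
    (i j : ι) : P.pairing i j * inner ℝ (P.root j) (P.root j) =
      2 * inner ℝ (P.root i) (P.root j) := by
  have h := hP j (P.root i) (P.root j)
  rw [P.reflection_apply_self, P.reflection_apply_root, inner_neg_right, inner_sub_left,
    real_inner_smul_left] at h
  linarith

lemma quotBase_image (b : P.Base) (s : Set ι) :
    quotBase (P.root '' b.support) (P.root '' s) =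
      Set.range fun k : ↥((b.support : Set ι) \ s) => proj (P.root '' s) (P.root k) := by
  ext x
  constructor
  · rintro ⟨_, ⟨⟨i, hi, rfl⟩, his⟩, rfl⟩
    exact ⟨⟨i, hi, fun h => his ⟨i, h, rfl⟩⟩, rfl⟩
  · rintro ⟨⟨i, hi, his⟩, rfl⟩
    exact ⟨_, ⟨⟨i, hi, rfl⟩, fun h => his (P.root.injective.mem_set_image.1 h)⟩, rfl⟩

/-- The images of the simple roots outside `s` form a basis of the quotient by the span of the
simple roots in `s`. -/
lemma exists_basis_quotient [P.IsRootSystem] (b : P.Base) {s : Set ι} (hs : s ⊆ b.support) :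
    ∃ B : Basis ↥((b.support : Set ι) \ s) ℝ (E ⧸ Submodule.span ℝ (P.root '' s)),
      ∀ k, B k = proj (P.root '' s) (P.root k) := by
  have hli : LinearIndepOn ℝ (proj (P.root '' s) ∘ P.root) ((b.support : Set ι) \ s) := by
    have := b.linearIndepOn_root
    rw [← Set.union_sdiff_cancel hs] at this
    exact ((linearIndepOn_union_iff_quotient Set.disjoint_sdiff_right).1 this).2
  refine ⟨Basis.mk hli ?_, fun k => Basis.mk_apply _ _ _⟩
  have htop : Submodule.span ℝ (P.root '' b.support) = ⊤ := by
    rw [b.span_root_support]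
    exact RootPairing.IsRootSystem.span_root_eq_top
  rw [← (Submodule.span ℝ (P.root '' s)).range_mkQ, LinearMap.range_eq_map, ← htop,
    ← Submodule.span_image, Submodule.span_le]
  rintro _ ⟨_, ⟨i, hi, rfl⟩, rfl⟩
  by_cases his : i ∈ s
  · have h0 : proj (P.root '' s) (P.root i) = 0 :=
      proj_eq_zero.2 (Submodule.subset_span ⟨i, his, rfl⟩)
    change proj (P.root '' s) (P.root i) ∈ _
    rw [h0]
    exact zero_mem _
  · exact Submodule.subset_span ⟨⟨i, hi, his⟩, rfl⟩

variable [FiniteDimensional ℝ E]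

lemma inner_mk_mk_of_mem_orthogonal {K : Submodule ℝ E} {x : E} (hx : x ∈ Kᗮ) (y : E) :
    inner ℝ (K.mkQ x) (K.mkQ y) = inner ℝ x y := by
  obtain ⟨z, hz, w, hw, rfl⟩ := K.exists_add_mem_mem_orthogonal y
  have h1 : K.mkQ (z + w) = K.mkQ w := by
    rw [map_add, Submodule.mkQ_apply, (Submodule.Quotient.mk_eq_zero K).2 hz, zero_add]
  rw [h1, inner_add_right, Submodule.inner_left_of_mem_orthogonal hz hx, zero_add]
  exact Submodule.Quotient.inner_mk_mk K x w hx hw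

variable [Finite ι]

/-- Two elements of a quotient root system with negative inner product have lifts with negative
inner product: the sum of all lifts of the first one is orthogonal to the kernel of the
projection. -/
lemma exists_lift_inner_neg
    (hP : ∀ (i : ι) (x y : E), inner ℝ (P.reflection i x) (P.reflection i y) = inner ℝ x y)
    (s : Set ι) (i : ι) (c : E)
    (h : inner ℝ (proj (P.root '' s) (P.root i)) (proj (P.root '' s) c) < 0) :
    ∃ l, proj (P.root '' s) (P.root l) = proj (P.root '' s) (P.root i) ∧
      inner ℝ (P.root l) c < 0 := by
  classical
  have := Fintype.ofFinite ι
  set A : Finset ι := {l | proj (P.root '' s) (P.root l) = proj (P.root '' s) (P.root i)} with hA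
  have hAmem : ∀ l, l ∈ A ↔ proj (P.root '' s) (P.root l) = proj (P.root '' s) (P.root i) := by
    exact fun l => Finset.mem_filter_univ l
  have hperm : ∀ k ∈ s, ∀ l, P.reflectionPerm k l ∈ A ↔ l ∈ A := by
    intro k hk l
    have h0 : proj (P.root '' s) (P.root k) = 0 :=
      proj_eq_zero.2 (Submodule.subset_span ⟨k, hk, rfl⟩)
    rw [hAmem, hAmem, P.root_reflectionPerm, P.reflection_apply_root, map_sub, map_smul, h0,
      smul_zero, sub_zero]
  set v := ∑ l ∈ A, P.root l with hv
  have hvorth : v ∈ (Submodule.span ℝ (P.root '' s))ᗮ := by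
    rw [Submodule.mem_orthogonal]
    intro u hu
    refine Submodule.span_induction ?_ (by simp) ?_ ?_ hu
    · rintro _ ⟨k, hk, rfl⟩
      have h1 : P.reflection k v = v := by
        rw [hv, map_sum]
        refine Finset.sum_bij' (fun l _ => P.reflectionPerm k l)
          (fun l _ => P.reflectionPerm k l) (fun l hl => (hperm k hk l).2 hl)
          (fun l hl => (hperm k hk l).2 hl) (by simp) (by simp) (fun l _ => ?_)
        rw [P.root_reflectionPerm]
      have h2 := hP k (P.root k) v
      rw [h1, P.reflection_apply_self, inner_neg_left] at h2
      linarith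
    · intro x y _ _ h1 h2
      rw [inner_add_left, h1, h2, add_zero]
    · intro a x _ h1
      rw [real_inner_smul_left, h1, mul_zero]
  have h1 : proj (P.root '' s) v = (A.card : ℝ) • proj (P.root '' s) (P.root i) := by
    rw [hv, map_sum, Finset.sum_congr rfl fun l hl => (hAmem l).1 hl, Finset.sum_const,
      Nat.cast_smul_eq_nsmul]
  have hcard : 0 < A.card := Finset.card_pos.2 ⟨i, (hAmem i).2 rfl⟩
  have h2 : ∑ l ∈ A, inner ℝ (P.root l) c < 0 := by
    rw [← sum_inner, ← hv, ← inner_mk_mk_of_mem_orthogonal hvorth, h1, real_inner_smul_left]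
    exact mul_neg_of_pos_of_neg (by exact_mod_cast hcard) h
  obtain ⟨l, hl, hlc⟩ := Finset.exists_lt_of_sum_lt (s := A) (f := fun l => inner ℝ (P.root l) c)
    (g := fun _ => (0 : ℝ)) (by simpa using h2)
  exact ⟨l, (hAmem l).1 hl, hlc⟩

/-- A quotient root system is a root system in the sense of `IsRootSystem`. For `add_root`, a pair
of roots with negative inner product is lifted to such a pair upstairs. -/
lemma isRootSystem_quotRoots [P.IsCrystallographic]
    (hP : ∀ (i : ι) (x y : E), inner ℝ (P.reflection i x) (P.reflection i y) = inner ℝ x y)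
    (b : P.Base) {s : Set ι}
    (B : Basis ↥((b.support : Set ι) \ s) ℝ (E ⧸ Submodule.span ℝ (P.root '' s)))
    (hB : ∀ k, B k = proj (P.root '' s) (P.root k)) :
    IsRootSystem B (quotRoots (Set.range P.root) (P.root '' s)) := by
  have hrange : Set.range B = quotBase (P.root '' b.support) (P.root '' s) := by
    rw [quotBase_image]
    exact congrArg Set.range (funext hB)
  have hnonneg : ∀ y ∈ AddSubmonoid.closure (Set.range B),
      ∃ n : ↥((b.support : Set ι) \ s) → ℤ, (∀ k, B.repr y k = n k) ∧ ∀ k, 0 ≤ n k := by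
    classical
    intro y hy
    refine AddSubmonoid.closure_induction (motive := fun y _ =>
      ∃ n : ↥((b.support : Set ι) \ s) → ℤ, (∀ k, B.repr y k = n k) ∧ ∀ k, 0 ≤ n k) ?_
      ⟨0, by simp, by simp⟩ ?_ hy
    · rintro _ ⟨k, rfl⟩
      refine ⟨Pi.single k 1, fun j => ?_, fun j => ?_⟩
      · rw [Basis.repr_self, Finsupp.single_apply, Pi.single_apply]
        simp [eq_comm]
      · rw [Pi.single_apply]
        split_ifs <;> simp
    · rintro y z - - ⟨n, hn, hn0⟩ ⟨m, hm, hm0⟩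
      exact ⟨n + m, fun k => by simp [hn, hm], fun k => add_nonneg (hn0 k) (hm0 k)⟩
  have hsign : ∀ α ∈ quotRoots (Set.range P.root) (P.root '' s),
      α ∈ AddSubmonoid.closure (Set.range B) ∨ -α ∈ AddSubmonoid.closure (Set.range B) := by
    rintro _ ⟨-, _, ⟨i, rfl⟩, rfl⟩
    rw [hrange, ← map_neg]
    exact (b.root_mem_or_neg_mem i).imp proj_mem_closure proj_mem_closure
  refine ⟨fun x hx => ?_, fun h => h.1 rfl, ?_, fun k => ?_, fun α hα => ?_, fun α => ?_, ?_⟩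
  · rw [Submodule.inner_quotient_eq, inner_self_eq_zero] at hx
    exact (LinearIsometryEquiv.map_eq_zero_iff _).1 hx
  · rintro _ ⟨h0, _, ⟨i, rfl⟩, rfl⟩
    refine ⟨neg_ne_zero.2 h0, P.root (P.reflectionPerm i i), ⟨_, rfl⟩, ?_⟩
    rw [P.root_reflectionPerm, P.reflection_apply_self, map_neg]
  · exact ⟨B.ne_zero k, P.root k, ⟨_, rfl⟩, (hB k).symm⟩
  · rcases hsign α hα with h | h
    · obtain ⟨n, hn, hn0⟩ := hnonneg _ h
      exact ⟨n, hn, Or.inl hn0⟩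
    · obtain ⟨n, hn, hn0⟩ := hnonneg _ h
      refine ⟨-n, fun k => ?_, Or.inr fun k => by simpa using hn0 k⟩
      have := hn k
      rw [map_neg, Finsupp.neg_apply] at this
      rw [Pi.neg_apply, Int.cast_neg, ← this, neg_neg]
  · constructor
    · rintro ⟨hα, h⟩
      obtain ⟨n, hn, hn0⟩ := hnonneg _ h
      exact ⟨hα, fun k => by rw [hn]; exact_mod_cast hn0 k⟩
    · rintro ⟨hα, h⟩
      refine ⟨hα, (hsign α hα).resolve_right fun h' => hα.1 ?_⟩
      obtain ⟨n, hn, hn0⟩ := hnonneg _ h'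
      refine B.repr.map_eq_zero_iff.1 (Finsupp.ext fun k => le_antisymm ?_ (h k))
      have h1 := hn k
      have h2 : (0 : ℝ) ≤ n k := by exact_mod_cast hn0 k
      rw [map_neg, Finsupp.neg_apply] at h1
      rw [Finsupp.zero_apply]
      linarith
  · rintro _ ⟨hα0, _, ⟨i, rfl⟩, rfl⟩ _ ⟨hβ0, _, ⟨j, rfl⟩, rfl⟩ hneg h0
    obtain ⟨l, hl, hlj⟩ := exists_lift_inner_neg hP s i _ hneg
    rw [← hl, ← map_add] at h0 ⊢
    have hpair : P.pairingIn ℤ l j < 0 := by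
      have h1 := pairing_mul_inner hP l j
      have h2 : P.pairing l j < 0 := by
        have h3 : 0 ≤ inner ℝ (P.root j) (P.root j) := real_inner_self_nonneg
        by_contra h4
        have := mul_nonneg (not_lt.1 h4) h3
        linarith
      rw [← P.algebraMap_pairingIn ℤ, eq_intCast] at h2
      exact_mod_cast h2
    refine ⟨h0, _, P.root_add_root_mem_of_pairingIn_neg hpair fun h => h0 ?_, rfl⟩
    rw [h, neg_add_cancel, map_zero]

end Quotient

end QRS


theorem mainTheorem5
    {E : Type*} [NormedAddCommGroup E] [InnerProductSpace ℝ E] [FiniteDimensional ℝ E]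
    {ι N : Type*} [Finite ι] [AddCommGroup N] [Module ℝ N]
    -- the root system `Δ = {P.root i}` in the Euclidean space `E`, with base `Σ = b.support`
    (P : RootPairing ι ℝ E N) [P.IsRootSystem] [P.IsCrystallographic] [P.IsReduced]
    (hP : ∀ (i : ι) (x y : E), inner ℝ (P.reflection i x) (P.reflection i y) = inner ℝ x y)
    (b : P.Base)
    -- the quotient root system `R = Δ / J` with base `S = Σ / J`
    (J : Set E) (hJ : J ⊆ P.root '' b.support)
    (R S : Set (E ⧸ Submodule.span ℝ J))
    (hR : R = QRS.quotRoots (Set.range P.root) J)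
    (hS : S = QRS.quotBase (P.root '' b.support) J)
    (hconn : (QRS.adjacencyDiagram S).Connected)
    (Φ : Set (E ⧸ Submodule.span ℝ J)) (hΦ : QRS.IsInversionSet R S Φ)
    (I : Set (E ⧸ Submodule.span ℝ J)) (hI : QRS.IsCanonicallyInflated R S I Φ) :
    (∀ C, QRS.IsComponent Φ (QRS.pos R S \ Φ) C → I ∈ QRS.gen R S C) ∧
    (∀ Φ₁ Φ₂, QRS.IsInversionSet R S Φ₁ → QRS.IsInversionSet R S Φ₂ →
      Disjoint Φ₁ Φ₂ → Φ = Φ₁ ∪ Φ₂ →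
      I ∈ QRS.gen R S Φ₁ ∧ I ∈ QRS.gen R S Φ₂) := by
  obtain ⟨s, hs, rfl⟩ : ∃ s ⊆ (b.support : Set ι), J = P.root '' s :=
    ⟨b.support ∩ P.root ⁻¹' J, Set.inter_subset_left, by
      rw [Set.image_inter_preimage, Set.inter_eq_right.2 hJ]⟩
  obtain ⟨B, hB⟩ := QRS.exists_basis_quotient b hs
  have H := QRS.isRootSystem_quotRoots hP b B hB
  have hSB : S = Set.range B := by
    rw [hS, QRS.quotBase_image]
    exact congrArg Set.range (funext fun k => (hB k).symm)
  have := Fintype.ofFinite ↥((b.support : Set ι) \ s)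
  subst hR hSB
  exact H.components_and_decompositions_mem_gen (QRS.forall_eq_univ_of_connected B hconn) hΦ hI
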